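/- **Setting.** Let $0<q<1$, $0<\alpha<1$, $m>0$, $0<T<\infty$. Let $\mathcal L$ be a self-adjoint operator on a separable Hilbert space $H$ with an orthonormal basis of eigenvectors $(\psi_k)_{k\in I}$, $I$ countable, $\mathcal L\psi_k=\lambda_k\psi_k$, $\lambda_k\ge 0$. For $d\in\mathbb R$ let $\mathcal H^d_{\mathcal L}$ be the space of series $a=\sum_k a_k\psi_k$ with $$\|a\|^2_{\mathcal H^d_{\mathcal L}}=\sum_{k\in I}(1+\lambda_k)^d|a_k|^2<\infty .$$ For $d\ge0$ this is $\{v\in H:(I+\mathcal L)^{d/2}v\in H\}$, with $a_k=\langle v,\psi_k\rangle$; for $d<0$ it is the completion of $H$ in this norm. The operator acts by $\mathcal La=\sum_k\lambda_ka_k\psi_k$. Write $(a;q)_\infty=\prod_{k\ge0}(1-q^ka)$, $\Gamma_q(x)=\frac{(q;q)_\infty}{(q^x;q)_\infty}(1-q)^{1-x}$, $D_qu(t)=\frac{u(t)-u(qt)}{(1-q)t}$, $\int_0^t g\,d_qs=(1-q)t\sum_{n\ge0}q^ng(tq^n)$, and $${}^cD^\alpha_qu(t)=\frac1{\Gamma_q(1-\alpha)}\int_0^t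 t^{-\alpha}\frac{(qs/t;q)_\infty}{(q^{1-\alpha}s/t;q)_\infty}\,D_qu(s)\,d_qs .$$ Let $e_{\alpha,1}(z;q)$ be the real-analytic function on $(-\infty,(1-q)^{-\alpha})$ which equals $\sum_{k\ge0}z^k/\Gamma_q(\alpha k+1)$ for $|z|(1-q)^\alpha<1$. The space $L^\infty_q([0,T];\mathcal H^{s}_{\mathcal L})$ consists of the functions $u:[0,T]\to\mathcal H^s_{\mathcal L}$ that are bounded. The space $W^\alpha_q([0,T];\mathcal H^s_{\mathcal L})$ consists of the bounded functions $u:[0,T]\to\mathcal H^s_{\mathcal L}$ that are $q$-regular at $0$ (that is, $u(tq^n)\to u(0)$ in $\mathcal H^s_{\mathcal L}$ as $n\to\infty$, for every $t\in(0,T]$), for which the Jackson sum defining ${}^cD^\alpha_qu(t)$ converges absolutely in $\mathcal H^s_{\mathcal L}$ for every $t\in(0,T]$, and for which ${}^cD^\alpha_qu$ is bounded on $(0,T]$ with values in $\mathcal H^s_{\mathcal L}$. **Theorem 5.1.** There is a constant $C>0$, depending only on $q,\alpha,m,T$ and $\mathcal L$, such that for all $d\in\mathbb R$ and all $\varphi,\rho\in\mathcal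 H^{d+2}_{\mathcal L}$ the following holds. There is a unique pair $(u,f)$, with $u\in L^\infty_q([0,T];\mathcal H^{d+2}_{\mathcal L})\cap W^\alpha_q([0,T];\mathcal H^d_{\mathcal L})$ and $f$ a series $\sum_kf_k\psi_k$ independent of $t$, such that $${}^cD^\alpha_qu(t)+\mathcal Lu(t)+mu(t)=f\quad(0<t\le T),\qquad u(0)=\varphi,\qquad u(T)=\rho .$$ Moreover $f\in\mathcal H^d_{\mathcal L}$; if $d\ge0$, then $u(t)$ lies in the domain of $\mathcal L$ for $0<t\le T$, $f\in H$, and the equation, including the absolute convergence of the Jackson sum, holds in $H$. All numbers $1-e_{\alpha,1}(-(\lambda_k+m)T^\alpha;q)$ are positive, and $$u(t)=\varphi+\sum_{k\in I}\frac{[\varphi_k-\rho_k]\,[e_{\alpha,1}(-(\lambda_k+m)t^\alpha;q)-1]}{1-e_{\alpha,1}(-(\lambda_k+m)T^\alpha;q)}\,\psi_k\qquad(0\le t\le T),$$ $$f=\mathcal L\varphi+m\varphi-\sum_{k\in I}\frac{(\lambda_k+m)[\varphi_k-\rho_k]}{1-e_{\alpha,1}(-(\lambda_k+m)T^\alpha;q)}\,\psi_k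 ,$$ with convergence in $\mathcal H^{d+2}_{\mathcal L}$ and in $\mathcal H^d_{\mathcal L}$ respectively. Finally $$\|{}^cD^\alpha_qu(t)\|^2_{\mathcal H^d_{\mathcal L}}+\|u(t)\|^2_{\mathcal H^{d+2}_{\mathcal L}}\le C\left(\|\varphi\|^2_{\mathcal H^{d+2}_{\mathcal L}}+\|\rho\|^2_{\mathcal H^{d+2}_{\mathcal L}}\right)\quad(0<t\le T),$$ $$\|f\|^2_{\mathcal H^d_{\mathcal L}}\le C\left(\|\varphi\|^2_{\mathcal H^{d+2}_{\mathcal L}}+\|\rho\|^2_{\mathcal H^{d+2}_{\mathcal L}}\right).$$ -/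

import Mathlib

open Filter Topology Set
open scoped InnerProductSpace

noncomputable section

/-! ### Scalar quantum calculus -/

/-- The infinite `q`-shifted factorial `(a; q)_∞ = ∏_{k ≥ 0} (1 - q ^ k a)`, for `0 < q < 1`. -/
def qPochInf (q a : ℝ) : ℝ := ∏' k : ℕ, (1 - q ^ k * a)

/-- The `q`-gamma function `Γ_q(x) = (q; q)_∞ / (q ^ x; q)_∞ * (1 - q) ^ (1 - x)`. -/
def qGamma (q x : ℝ) : ℝ := qPochInf q q / qPochInf q (q ^ x) * (1 - q) ^ (1 - x)

/-- The `q`-power `(x - q s)_q ^ (β - 1) = x ^ (β - 1) (q s / x; q)_{β - 1}`, where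
`(a; q)_γ = (a; q)_∞ / (q ^ γ a; q)_∞`. -/
def qKernel (q β x s : ℝ) : ℝ :=
  x ^ (β - 1) * (qPochInf q (q * s / x) / qPochInf q (q ^ (β - 1) * (q * s / x)))

/-- `E` is the `q`-Mittag-Leffler function `z ↦ e_{α, β}(z; q)` on `(-∞, (1 - q) ^ (-α))`: it is the
sum of the power series `∑ z ^ k / Γ_q(α k + β)` on the disc of convergence `|z (1 - q) ^ α| < 1`,
and it is real analytic on the whole half-line, so it continues this sum to all negative `z`. -/
structure IsQMittagLeffler (q α β : ℝ) (E : ℝ → ℝ) : Prop where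
  hasSum : ∀ z : ℝ, |z * (1 - q) ^ α| < 1 →
    HasSum (fun k : ℕ => z ^ k / qGamma q (α * k + β)) (E z)
  analytic : AnalyticOnNhd ℝ E (Iio ((1 - q) ^ (-α)))

open Classical in
/-- The `q`-Mittag-Leffler function `e_{α, β}(z; q)` for real `z < (1 - q) ^ (-α)`: the analytic
continuation of the power series `∑ z ^ k / Γ_q(α k + β)` along the real axis. -/
def qMittagLeffler (q α β z : ℝ) : ℝ :=
  if h : ∃ E : ℝ → ℝ, IsQMittagLeffler q α β E then h.choose z else 0

/-- The analytic continuation is unique. -/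
theorem IsQMittagLeffler.eqOn {q α β : ℝ} (hq : q < 1) {E F : ℝ → ℝ}
    (hE : IsQMittagLeffler q α β E) (hF : IsQMittagLeffler q α β F) :
    EqOn E F (Iio ((1 - q) ^ (-α))) := by
  have h0 : (0 : ℝ) ∈ Iio ((1 - q) ^ (-α)) := Real.rpow_pos_of_pos (by linarith) _
  refine hE.analytic.eqOn_of_preconnected_of_eventuallyEq hF.analytic isPreconnected_Iio h0 ?_
  have hc : ContinuousAt (fun z : ℝ => |z * (1 - q) ^ α|) 0 := by fun_prop
  have : ∀ᶠ z in 𝓝 (0 : ℝ), |z * (1 - q) ^ α| < 1 :=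
    hc.eventually_lt continuousAt_const (by simp)
  filter_upwards [this] with z hz
  exact (hE.hasSum z hz).unique (hF.hasSum z hz)

theorem IsQMittagLeffler.qMittagLeffler_eqOn {q α β : ℝ} (hq : q < 1) {E : ℝ → ℝ}
    (hE : IsQMittagLeffler q α β E) :
    EqOn (qMittagLeffler q α β) E (Iio ((1 - q) ^ (-α))) := by
  intro z hz
  have h : ∃ E : ℝ → ℝ, IsQMittagLeffler q α β E := ⟨E, hE⟩
  rw [qMittagLeffler, dif_pos h]
  exact h.choose_spec.eqOn hq hE hz

/-! ### Vector-valued quantum calculus -/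

section Vector

variable (𝕜 : Type*) [RCLike 𝕜] {E : Type*} [AddCommGroup E] [Module 𝕜 E] [TopologicalSpace E]

/-- The `q`-derivative `D_q u (t) = (u t - u (q t)) / (t (1 - q))`. -/
def qDeriv (q : ℝ) (u : ℝ → E) (t : ℝ) : E :=
  (((t * (1 - q))⁻¹ : ℝ) : 𝕜) • (u t - u (q * t))

/-- The terms `q ^ n g(a q ^ n)` of the Jackson integral of `g` over `[0, a]`. -/
def jacksonTerm (q a : ℝ) (g : ℝ → E) (n : ℕ) : E :=
  ((q ^ n : ℝ) : 𝕜) • g (a * q ^ n)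

/-- The Jackson integral `∫_0^a g d_q s = (1 - q) a ∑ q ^ n g(a q ^ n)`. -/
def jacksonIntegral (q a : ℝ) (g : ℝ → E) : E :=
  (((1 - q) * a : ℝ) : 𝕜) • ∑' n : ℕ, jacksonTerm 𝕜 q a g n

/-- The integrand `(x - q s)_q ^ (β - 1) g(s)` of the Riemann-Liouville integral at `x`. -/
def rlIntegrand (q β : ℝ) (g : ℝ → E) (x s : ℝ) : E :=
  ((qKernel q β x s : ℝ) : 𝕜) • g s

/-- The Riemann-Liouville `q`-integral of order `β > 0` with base point `0`. -/
def rlIntegral (q β : ℝ) (g : ℝ → E) (x : ℝ) : E :=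
  (((qGamma q β)⁻¹ : ℝ) : 𝕜) • jacksonIntegral 𝕜 q x (rlIntegrand 𝕜 q β g x)

/-- The terms of the Jackson sum that defines the Caputo derivative of order `α` of `u` at `t`. -/
def caputoTerm (q α : ℝ) (u : ℝ → E) (t : ℝ) (n : ℕ) : E :=
  jacksonTerm 𝕜 q t (rlIntegrand 𝕜 q (⌈α⌉₊ - α) ((qDeriv 𝕜 q)^[⌈α⌉₊] u) t) n

/-- The Caputo `q`-derivative `I_q ^ (⌈α⌉ - α) D_q ^ ⌈α⌉ u` of noninteger order `α > 0`. -/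
def caputo (q α : ℝ) (u : ℝ → E) (t : ℝ) : E :=
  rlIntegral 𝕜 q (⌈α⌉₊ - α) ((qDeriv 𝕜 q)^[⌈α⌉₊] u) t

end Vector

/-! ### The Sobolev scale of a positive operator with discrete spectrum

Throughout `ψ` is an orthonormal basis of eigenvectors with eigenvalues `lam k ≥ 0`. A family
`a : ι → 𝕜` stands for the formal eigenfunction series `∑ a k ψ_k`; the space of these series is
given the product topology (coefficientwise convergence), and contains `H` through the Fourier
coefficients. -/

section Scale

variable {ι 𝕜 : Type*} [RCLike 𝕜]

/-- The formal series of a vector: its Fourier coefficients `⟨v, ψ_k⟩`. -/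
def eigenSeries {H : Type*} [NormedAddCommGroup H] [InnerProductSpace 𝕜 H]
    (ψ : HilbertBasis ι 𝕜 H) (v : H) : ι → 𝕜 := fun k => ⟪ψ k, v⟫_𝕜

/-- The action of the operator on formal series: `∑ a k ψ_k ↦ ∑ lam k * a k ψ_k`. -/
def seriesOp (lam : ι → ℝ) (a : ι → 𝕜) : ι → 𝕜 := fun k => (lam k : 𝕜) * a k

/-- Membership in the Sobolev space of order `d`. -/
def MemSobolev (lam : ι → ℝ) (d : ℝ) (a : ι → 𝕜) : Prop :=
  Summable fun k => (1 + lam k) ^ d * ‖a k‖ ^ 2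

/-- The Sobolev norm `(∑ (1 + lam k) ^ d |a k| ^ 2) ^ (1 / 2)` of order `d`. -/
def sobolevNorm (lam : ι → ℝ) (d : ℝ) (a : ι → 𝕜) : ℝ :=
  √(∑' k, (1 + lam k) ^ d * ‖a k‖ ^ 2)

/-- The family `g` sums (unconditionally) to `a` in the Sobolev space of order `d`. -/
def SobolevHasSum (lam : ι → ℝ) (d : ℝ) (g : ι → ι → 𝕜) (a : ι → 𝕜) : Prop :=
  MemSobolev lam d a ∧ (∀ k, MemSobolev lam d (g k)) ∧
    Tendsto (fun s : Finset ι => sobolevNorm lam d (a - ∑ k ∈ s, g k)) atTop (𝓝 0)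

/-- For `d ≥ 0` the Sobolev space of order `d` consists of (the series of) vectors of `H`. -/
theorem MemSobolev.exists_eigenSeries_eq {H : Type*} [NormedAddCommGroup H] [InnerProductSpace 𝕜 H]
    (ψ : HilbertBasis ι 𝕜 H) {lam : ι → ℝ} (hlam : ∀ k, 0 ≤ lam k) {d : ℝ} (hd : 0 ≤ d)
    {a : ι → 𝕜} (ha : MemSobolev lam d a) : ∃ v : H, eigenSeries ψ v = a := by
  have h2 : Summable fun k => ‖a k‖ ^ 2 := by
    refine Summable.of_nonneg_of_le (fun k => by positivity) (fun k => ?_) ha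
    have : 1 ≤ (1 + lam k) ^ d := Real.one_le_rpow (by linarith [hlam k]) hd
    nlinarith [sq_nonneg ‖a k‖]
  have hm : Memℓp a 2 := by
    refine memℓp_gen ?_
    simpa using h2
  refine ⟨ψ.repr.symm ⟨a, hm⟩, ?_⟩
  funext k
  rw [eigenSeries, ← HilbertBasis.repr_apply_apply, LinearIsometryEquiv.apply_symm_apply]

/-- On its domain, a self-adjoint operator with eigenvectors `ψ k` acts on series by `seriesOp`. -/
theorem eigenSeries_apply_eq_seriesOp {H : Type*} [NormedAddCommGroup H] [InnerProductSpace 𝕜 H]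
    [CompleteSpace H] {L : H →ₗ.[𝕜] H} (hL : IsSelfAdjoint L) (ψ : HilbertBasis ι 𝕜 H)
    {lam : ι → ℝ} (hψ : ∀ k, ∃ h : ψ k ∈ L.domain, L ⟨ψ k, h⟩ = (lam k : 𝕜) • ψ k)
    (v : L.domain) : eigenSeries ψ (L v) = seriesOp lam (eigenSeries ψ (v : H)) := by
  funext k
  obtain ⟨h, hk⟩ := hψ k
  have h1 := LinearPMap.adjoint_isFormalAdjoint hL.dense_domain
  rw [LinearPMap.isSelfAdjoint_def.1 hL] at h1
  have h2 := h1 ⟨ψ k, h⟩ v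
  rw [hk, inner_smul_left] at h2
  simp only [eigenSeries, seriesOp]
  simpa using h2.symm

/-! ### Function spaces and the inverse source problem -/

/-- `u ∈ L_q^∞([0, T]; H^s)`: values in `H^s`, and a bounded `H^s` norm on `[0, T]`. -/
def MemLinfty (lam : ι → ℝ) (T s : ℝ) (u : ℝ → ι → 𝕜) : Prop :=
  (∀ t ∈ Icc 0 T, MemSobolev lam s (u t)) ∧
    BddAbove ((fun t => sobolevNorm lam s (u t)) '' Icc 0 T)

/-- `u ∈ W_q^α([0, T]; H^s)`: `u` and its Caputo `q`-derivative are bounded with values in `H^s`.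
As always for `q`-difference equations with data at `0`, functions are `q`-regular at `0`, that is,
`u (t q ^ n) → u 0`, and the Jackson sums converge absolutely. -/
structure MemW (lam : ι → ℝ) (q α T s : ℝ) (u : ℝ → ι → 𝕜) : Prop where
  memLinfty : MemLinfty lam T s u
  regular : ∀ t ∈ Ioc 0 T,
    Tendsto (fun n : ℕ => sobolevNorm lam s (u (t * q ^ n) - u 0)) atTop (𝓝 0)
  summable : ∀ t ∈ Ioc 0 T, Summable fun n : ℕ => sobolevNorm lam s (caputoTerm 𝕜 q α u t n)
  caputo_mem : ∀ t ∈ Ioc 0 T, MemSobolev lam s (caputo 𝕜 q α u t)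
  caputo_bdd : BddAbove ((fun t => sobolevNorm lam s (caputo 𝕜 q α u t)) '' Ioc 0 T)

/-- The pair `(u, f)` is a generalised solution, of order `d`, of the inverse source problem
`ᶜD_q^α u + L u + m u = f` on `(0, T]`, `u 0 = φ`, `u T = ρ`. -/
structure IsInverseSolution (lam : ι → ℝ) (q α m T d : ℝ) (φ ρ : ι → 𝕜)
    (u : ℝ → ι → 𝕜) (f : ι → 𝕜) : Prop where
  memLinfty : MemLinfty lam T (d + 2) u
  memW : MemW lam q α T d u
  equation : ∀ t ∈ Ioc 0 T, caputo 𝕜 q α u t + seriesOp lam (u t) + (m : 𝕜) • u t = f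
  initial : u 0 = φ
  final : u T = ρ

end Scale

end

/-!
By the `q`-binomial theorem `1 / Γ_q(x)` is, up to a power of `1 - q`, a power series in `q ^ x`.
This turns the Mittag-Leffler power series into a series of partial fractions with poles on the
positive real axis, which is its analytic continuation to the negative axis. The same theorem gives
the generating function of the Caputo kernel on the lattice `t q ^ n`. The eigenfunction equation
`ᶜD_q^α e(-μ t^α) = -μ e(-μ t^α)` is thus a `q`-binomial identity for small arguments, and the
identity theorem extends it to the half-plane free of poles.

On the lattice the Caputo derivative pairs a positive decreasing kernel with the increments of the
function. Summation by parts turns this into a maximum principle, which gives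
`|e(-μ t^α)| ≤ 1 / (1 + (1 - q)^α μ t^α)` and forces uniqueness for each Fourier coefficient.
As `μ = lam k + m ≥ m > 0`, the denominators `1 - e(-μ T^α)` stay away from `0` uniformly in `k`,
and the theorem follows mode by mode, with one constant for the whole Sobolev scale.
-/

/-! ### The `q`-binomial theorem -/

section QBinomial

variable {q a b : ℝ}

theorem one_sub_pow_succ_pos (hq0 : 0 < q) (hq1 : q < 1) (n : ℕ) : 0 < 1 - q ^ (n + 1) :=
  sub_pos.2 (pow_lt_one₀ hq0.le hq1 n.succ_ne_zero)

theorem summable_qPochInf_factor (hq0 : 0 < q) (hq1 : q < 1) (a : ℝ) :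
    Summable fun k : ℕ => -(q ^ k * a) :=
  ((summable_geometric_of_lt_one hq0.le hq1).mul_right a).neg

theorem multipliable_qPochInf (hq0 : 0 < q) (hq1 : q < 1) (a : ℝ) :
    Multipliable fun k : ℕ => 1 - q ^ k * a := by
  simpa only [sub_eq_add_neg] using
    Real.multipliable_one_add_of_summable (summable_qPochInf_factor hq0 hq1 a)

theorem qPochInf_pos (hq0 : 0 < q) (hq1 : q < 1) (ha : a < 1) : 0 < qPochInf q a := by
  have hpos (k : ℕ) : 0 < 1 + -(q ^ k * a) := by
    rw [← sub_eq_add_neg, sub_pos]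
    calc q ^ k * a < q ^ k * 1 := mul_lt_mul_of_pos_left ha (pow_pos hq0 k)
      _ ≤ 1 := (mul_one _).trans_le (pow_le_one₀ hq0.le hq1.le)
  simp only [qPochInf, sub_eq_add_neg]
  rw [← Real.rexp_tsum_eq_tprod hpos
    (Real.summable_log_one_add_of_summable (summable_qPochInf_factor hq0 hq1 a))]
  exact Real.exp_pos _

theorem qPochInf_eq_prod_mul (hq0 : 0 < q) (hq1 : q < 1) (a : ℝ) (n : ℕ) :
    qPochInf q a = (∏ k ∈ Finset.range n, (1 - q ^ k * a)) * qPochInf q (q ^ n * a) := by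
  have hshift : (fun k : ℕ => 1 - q ^ (k + n) * a) = fun k => 1 - q ^ k * (q ^ n * a) := by
    simp only [pow_add, mul_assoc]
  rw [qPochInf, qPochInf, ← hshift]
  refine (Multipliable.prod_mul_tprod_nat_mul' (f := fun k : ℕ => 1 - q ^ k * a) ?_).symm
  rw [hshift]
  exact multipliable_qPochInf hq0 hq1 _

/-- The general term of the `q`-binomial series, in the homogeneous normalisation that for `a = 1`
gives `(b; q)_n / (q; q)_n` and for `a = 0` Euler's expansion of `(b; q)_∞`. -/
noncomputable def qBinomTerm (q a b : ℝ) (n : ℕ) : ℝ :=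
  ∏ i ∈ Finset.range n, (a - q ^ i * b) / (1 - q ^ (i + 1))

@[simp]
theorem qBinomTerm_zero : qBinomTerm q a b 0 = 1 := Finset.prod_range_zero _

theorem qBinomTerm_succ (n : ℕ) :
    qBinomTerm q a b (n + 1) = (a - q ^ n * b) / (1 - q ^ (n + 1)) * qBinomTerm q a b n := by
  rw [qBinomTerm, Finset.prod_range_succ, mul_comm, qBinomTerm]

theorem qBinomTerm_mul_mul (x : ℝ) (n : ℕ) :
    qBinomTerm q (x * a) (x * b) n = x ^ n * qBinomTerm q a b n := by
  simp only [qBinomTerm, mul_left_comm _ x, ← mul_sub, mul_div_assoc, Finset.prod_mul_distrib,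
    Finset.prod_const, Finset.card_range]

theorem summable_qBinomTerm (hq0 : 0 < q) (hq1 : q < 1) (ha : |a| < 1) :
    Summable (qBinomTerm q a b) := by
  obtain ⟨r, har, hr⟩ := exists_between ha
  have hpow : Tendsto (fun n : ℕ => q ^ n) atTop (𝓝 0) :=
    tendsto_pow_atTop_nhds_zero_of_lt_one hq0.le hq1
  have hratio : Tendsto (fun n : ℕ => |(a - q ^ n * b) / (1 - q ^ (n + 1))|) atTop (𝓝 |a|) := by
    simpa using (((hpow.mul_const b).const_sub a).div
      ((hpow.comp (tendsto_add_atTop_nat 1)).const_sub 1) (by norm_num)).abs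
  refine summable_of_ratio_norm_eventually_le hr ?_
  filter_upwards [hratio.eventually_le_const har] with n hn
  rw [qBinomTerm_succ, norm_mul]
  exact mul_le_mul_of_nonneg_right hn (norm_nonneg _)

theorem one_sub_mul_tsum_qBinomTerm (hq0 : 0 < q) (hq1 : q < 1) (ha : |a| < 1) :
    (1 - a) * ∑' n, qBinomTerm q a b n = (1 - b) * ∑' n, qBinomTerm q (q * a) (q * b) n := by
  have hs := summable_qBinomTerm (b := b) hq0 hq1 ha
  have hs' : Summable fun n => q ^ n * qBinomTerm q a b n := by
    refine Summable.of_norm_bounded hs.norm fun n => ?_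
    rw [norm_mul, norm_pow, Real.norm_of_nonneg hq0.le]
    exact mul_le_of_le_one_left (norm_nonneg _) (pow_le_one₀ hq0.le hq1.le)
  have hrec (n : ℕ) : qBinomTerm q a b (n + 1) - q ^ (n + 1) * qBinomTerm q a b (n + 1) =
      a * qBinomTerm q a b n - b * (q ^ n * qBinomTerm q a b n) := by
    have := (one_sub_pow_succ_pos hq0 hq1 n).ne'
    rw [qBinomTerm_succ]
    field_simp
  have hdiff : ∑' n, qBinomTerm q a b n - ∑' n, q ^ n * qBinomTerm q a b n =
      a * ∑' n, qBinomTerm q a b n - b * ∑' n, q ^ n * qBinomTerm q a b n := by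
    rw [← hs.tsum_sub hs', (hs.sub hs').tsum_eq_zero_add, tsum_congr hrec,
      (hs.mul_left a).tsum_sub (hs'.mul_left b), tsum_mul_left, tsum_mul_left]
    simp
  simp only [qBinomTerm_mul_mul]
  linear_combination hdiff

theorem prod_mul_tsum_qBinomTerm (hq0 : 0 < q) (hq1 : q < 1) (ha : |a| < 1) (N : ℕ) :
    (∏ k ∈ Finset.range N, (1 - q ^ k * a)) * ∑' n, qBinomTerm q a b n =
      (∏ k ∈ Finset.range N, (1 - q ^ k * b)) *
        ∑' n, qBinomTerm q (q ^ N * a) (q ^ N * b) n := by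
  induction N with
  | zero => simp
  | succ N ih =>
    have haN : |q ^ N * a| < 1 := by
      rw [abs_mul, abs_of_pos (pow_pos hq0 N)]
      exact mul_lt_one_of_nonneg_of_lt_one_right (pow_le_one₀ hq0.le hq1.le) (abs_nonneg a) ha
    have hstep := one_sub_mul_tsum_qBinomTerm (b := q ^ N * b) hq0 hq1 haN
    rw [← mul_assoc, ← mul_assoc, ← pow_succ'] at hstep
    rw [Finset.prod_range_succ, Finset.prod_range_succ, mul_right_comm, ih, mul_assoc,
      mul_comm _ (1 - q ^ N * a), hstep, mul_assoc]

theorem tendsto_tsum_qBinomTerm (hq0 : 0 < q) (hq1 : q < 1) (ha : |a| < 1) :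
    Tendsto (fun N : ℕ => ∑' n, qBinomTerm q (q ^ N * a) (q ^ N * b) n) atTop (𝓝 1) := by
  have hlim (n : ℕ) : Tendsto (fun N : ℕ => qBinomTerm q (q ^ N * a) (q ^ N * b) n) atTop
      (𝓝 (0 ^ n * qBinomTerm q a b n)) := by
    simp only [qBinomTerm_mul_mul]
    exact ((tendsto_pow_atTop_nhds_zero_of_lt_one hq0.le hq1).pow n).mul_const _
  have h0 : ∑' n, 0 ^ n * qBinomTerm q a b n = 1 := by
    rw [tsum_eq_single 0 fun n hn => by rw [zero_pow hn, zero_mul]]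
    simp
  rw [← h0]
  refine tendsto_tsum_of_dominated_convergence (summable_qBinomTerm (b := b) hq0 hq1 ha).norm hlim
    (Eventually.of_forall fun N n => ?_)
  rw [qBinomTerm_mul_mul, norm_mul, norm_pow, Real.norm_of_nonneg (pow_pos hq0 N).le]
  exact mul_le_of_le_one_left (norm_nonneg _)
    (pow_le_one₀ (pow_pos hq0 N).le (pow_le_one₀ hq0.le hq1.le))

theorem hasSum_qBinomTerm (hq0 : 0 < q) (hq1 : q < 1) (ha : |a| < 1) :
    HasSum (qBinomTerm q a b) (qPochInf q b / qPochInf q a) := by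
  have hprod (c : ℝ) : Tendsto (fun N => ∏ k ∈ Finset.range N, (1 - q ^ k * c)) atTop
      (𝓝 (qPochInf q c)) := (multipliable_qPochInf hq0 hq1 c).hasProd.tendsto_prod_nat
  have heq : qPochInf q a * ∑' n, qBinomTerm q a b n = qPochInf q b * 1 :=
    tendsto_nhds_unique ((hprod a).mul_const _) <|
      ((hprod b).mul (tendsto_tsum_qBinomTerm hq0 hq1 ha)).congr fun N =>
        (prod_mul_tsum_qBinomTerm hq0 hq1 ha N).symm
  have hpos := qPochInf_pos hq0 hq1 (abs_lt.1 ha).2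
  rw [mul_one, mul_comm, ← eq_div_iff hpos.ne'] at heq
  exact heq ▸ (summable_qBinomTerm hq0 hq1 ha).hasSum

end QBinomial

section PartialFractions

variable {q p : ℝ}

theorem hasSum_rows_of_hasSum_cols {ι κ E : Type*} [AddCommGroup E] [UniformSpace E]
    [IsUniformAddGroup E] [T2Space E] {F : ι × κ → E} {r : ι → E} {c : κ → E}
    {s : E} (hF : Summable F) (hr : ∀ i, HasSum (fun k => F (i, k)) (r i))
    (hc : ∀ k, HasSum (fun i => F (i, k)) (c k)) (hs : HasSum c s) : HasSum r s := by
  have hcols := ((Equiv.prodComm κ ι).hasSum_iff.2 hF.hasSum).prod_fiberwise hc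
  exact hcols.unique hs ▸ hF.hasSum.prod_fiberwise hr

/-- The coefficients of the partial fraction expansion `∑ b_j / (1 - z p ^ j)` of the
`q`-Mittag-Leffler function: up to the factor `(q; q)_∞⁻¹`, those of Euler's expansion of
`(q x; q)_∞` in powers of `x`. -/
noncomputable def mlPoleCoeff (q : ℝ) (j : ℕ) : ℝ := qBinomTerm q 0 q j / qPochInf q q

theorem hasSum_mlPoleCoeff_mul_pow (hq0 : 0 < q) (hq1 : q < 1) (x : ℝ) :
    HasSum (fun j => mlPoleCoeff q j * x ^ j) (qPochInf q (q * x) / qPochInf q q) := by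
  have hone : qPochInf q 0 = 1 := by simp [qPochInf]
  have h := (hasSum_qBinomTerm (a := x * 0) (b := x * q) hq0 hq1 (by simp)).div_const (qPochInf q q)
  simp only [qBinomTerm_mul_mul] at h
  rw [mul_zero, hone, div_one, mul_comm x q] at h
  exact h.congr_fun fun j => by rw [mlPoleCoeff]; ring

theorem summable_mlPoleCoeff (hq0 : 0 < q) (hq1 : q < 1) : Summable fun j => |mlPoleCoeff q j| := by
  simpa using (hasSum_mlPoleCoeff_mul_pow hq0 hq1 1).summable.abs

/-- The `q`-Mittag-Leffler function `e_{α, 1}(·; q)`, for `p = q ^ α` and in the variable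
`(1 - q) ^ α z`, as a partial fraction series on the half-plane `Re z < 1`. -/
noncomputable def mlSeries (q p : ℝ) (z : ℂ) : ℂ :=
  ∑' j : ℕ, (mlPoleCoeff q j : ℂ) / (1 - z * (p : ℂ) ^ j)

theorem ofReal_re_mlSeries (w : ℝ) : ((mlSeries q p w).re : ℂ) = mlSeries q p w := by
  have h : mlSeries q p w = ((∑' j : ℕ, mlPoleCoeff q j / (1 - w * p ^ j) : ℝ) : ℂ) := by
    rw [mlSeries]
    push_cast
    rfl
  rw [h, Complex.ofReal_re]

theorem re_mul_ofReal_pow_le (hp0 : 0 ≤ p) (hp1 : p ≤ 1) {r : ℝ} (hr : 0 ≤ r) {z : ℂ}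
    (hz : z.re ≤ r) (j : ℕ) : (z * (p : ℂ) ^ j).re ≤ r := by
  rw [← Complex.ofReal_pow, Complex.re_mul_ofReal]
  exact (mul_le_mul_of_nonneg_right hz (pow_nonneg hp0 j)).trans
    (mul_le_of_le_one_right hr (pow_le_one₀ hp0 hp1))

theorem one_sub_le_norm_one_sub_mul_pow (hp0 : 0 ≤ p) (hp1 : p ≤ 1) {r : ℝ} (hr : 0 ≤ r) {z : ℂ}
    (hz : z.re ≤ r) (j : ℕ) : 1 - r ≤ ‖1 - z * (p : ℂ) ^ j‖ :=
  (sub_le_sub_left (re_mul_ofReal_pow_le hp0 hp1 hr hz j) 1).trans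
    (Complex.re_le_norm (1 - z * (p : ℂ) ^ j))

theorem norm_mlSeries_term_le (hp0 : 0 ≤ p) (hp1 : p ≤ 1) {r : ℝ} (hr : 0 ≤ r) (hr1 : r < 1) {z : ℂ}
    (hz : z.re ≤ r) (j : ℕ) :
    ‖(mlPoleCoeff q j : ℂ) / (1 - z * (p : ℂ) ^ j)‖ ≤ |mlPoleCoeff q j| * (1 - r)⁻¹ := by
  rw [norm_div, Complex.norm_real, Real.norm_eq_abs, div_eq_mul_inv]
  have := one_sub_le_norm_one_sub_mul_pow hp0 hp1 hr hz j
  have : 0 < 1 - r := sub_pos.2 hr1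
  gcongr

theorem hasSum_mlSeries (hq0 : 0 < q) (hq1 : q < 1) (hp0 : 0 ≤ p) (hp1 : p ≤ 1) {z : ℂ}
    (hz : z.re < 1) :
    HasSum (fun j : ℕ => (mlPoleCoeff q j : ℂ) / (1 - z * (p : ℂ) ^ j)) (mlSeries q p z) :=
  (Summable.of_norm_bounded ((summable_mlPoleCoeff hq0 hq1).mul_right _)
    (norm_mlSeries_term_le hp0 hp1 (le_max_right z.re 0) (max_lt hz one_pos)
      (le_max_left z.re 0))).hasSum

theorem differentiableOn_mlSeries (hq0 : 0 < q) (hq1 : q < 1) (hp0 : 0 ≤ p) (hp1 : p ≤ 1) :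
    DifferentiableOn ℂ (mlSeries q p) {z | z.re < 1} := by
  intro z hz
  obtain ⟨r, hzr, hr1⟩ := exists_between (max_lt (mem_ofPred.1 hz) one_pos)
  obtain ⟨hzr, hr0⟩ := max_lt_iff.1 hzr
  have hopen : IsOpen {z : ℂ | z.re < r} := isOpen_lt Complex.continuous_re continuous_const
  have hdiff : DifferentiableOn ℂ (mlSeries q p) {z | z.re < r} := by
    refine Complex.differentiableOn_tsum_of_summable_norm
      ((summable_mlPoleCoeff hq0 hq1).mul_right _) (fun j => ?_) hopen
      fun j w hw => norm_mlSeries_term_le hp0 hp1 hr0.le hr1 (le_of_lt hw) j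
    refine DifferentiableOn.div (by fun_prop) (by fun_prop) fun w hw h0 => ?_
    have := one_sub_le_norm_one_sub_mul_pow hp0 hp1 hr0.le (le_of_lt hw) j
    rw [h0, norm_zero] at this
    linarith
  exact (hdiff.differentiableAt (hopen.mem_nhds hzr)).differentiableWithinAt

/-- A Lipschitz constant of `mlSeries` on the half-plane `Re z ≤ 0`. -/
noncomputable def mlLip (q : ℝ) : ℝ := ∑' j : ℕ, |mlPoleCoeff q j|

theorem mlLip_nonneg : 0 ≤ mlLip q := tsum_nonneg fun _ => abs_nonneg _

theorem norm_mlSeries_sub_le (hq0 : 0 < q) (hq1 : q < 1) (hp0 : 0 ≤ p) (hp1 : p ≤ 1) {r : ℝ}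
    (hr0 : 0 ≤ r) (hr1 : r < 1) {z w : ℂ} (hz : z.re ≤ r) (hw : w.re ≤ r) :
    ‖mlSeries q p z - mlSeries q p w‖ ≤ mlLip q * (‖z - w‖ / (1 - r) ^ 2) := by
  have hs (z : ℂ) (hz : z.re ≤ r) := hasSum_mlSeries hq0 hq1 hp0 hp1 (hz.trans_lt hr1)
  rw [mlLip, ← ((hs z hz).sub (hs w hw)).tsum_eq, ← tsum_mul_right]
  refine tsum_of_norm_bounded ((summable_mlPoleCoeff hq0 hq1).mul_right _).hasSum fun j => ?_
  have hr : 0 < 1 - r := sub_pos.2 hr1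
  have hzj := one_sub_le_norm_one_sub_mul_pow hp0 hp1 hr0 hz j
  have hwj := one_sub_le_norm_one_sub_mul_pow hp0 hp1 hr0 hw j
  have hdiff : (mlPoleCoeff q j : ℂ) / (1 - z * (p : ℂ) ^ j) -
      (mlPoleCoeff q j : ℂ) / (1 - w * (p : ℂ) ^ j) = mlPoleCoeff q j *
        ((z - w) * (p : ℂ) ^ j / ((1 - z * (p : ℂ) ^ j) * (1 - w * (p : ℂ) ^ j))) := by
    rw [div_sub_div _ _ (norm_pos_iff.1 (hr.trans_le hzj)) (norm_pos_iff.1 (hr.trans_le hwj)),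
      ← mul_div_assoc]
    congr 1
    ring
  rw [hdiff, norm_mul, Complex.norm_real, Real.norm_eq_abs, norm_div, norm_mul, norm_mul, norm_pow,
    Complex.norm_real, Real.norm_of_nonneg hp0, sq]
  have := mul_le_of_le_one_right (norm_nonneg (z - w)) (pow_le_one₀ (n := j) hp0 hp1)
  gcongr

/-- The coefficients of the power series of `mlSeries` at the origin. -/
noncomputable def mlCoeff (q p : ℝ) (k : ℕ) : ℝ := qPochInf q (q * p ^ k) / qPochInf q q

theorem norm_mul_ofReal_pow_le (hp0 : 0 ≤ p) (hp1 : p ≤ 1) (z : ℂ) (j : ℕ) :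
    ‖z * (p : ℂ) ^ j‖ ≤ ‖z‖ := by
  rw [norm_mul, norm_pow, Complex.norm_real, Real.norm_of_nonneg hp0]
  exact mul_le_of_le_one_right (norm_nonneg z) (pow_le_one₀ hp0 hp1)

theorem hasSum_mlCoeff (hq0 : 0 < q) (hq1 : q < 1) (hp0 : 0 ≤ p) (hp1 : p ≤ 1) {z : ℂ}
    (hz : ‖z‖ < 1) : HasSum (fun k : ℕ => (mlCoeff q p k : ℂ) * z ^ k) (mlSeries q p z) := by
  have hF : Summable fun x : ℕ × ℕ => (mlPoleCoeff q x.2 : ℂ) * (z * (p : ℂ) ^ x.2) ^ x.1 := by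
    refine Summable.of_norm_bounded ((summable_geometric_of_lt_one (norm_nonneg z) hz).mul_of_nonneg
      (summable_mlPoleCoeff hq0 hq1) (fun _ => by positivity) fun _ => abs_nonneg _) fun x => ?_
    rw [norm_mul, Complex.norm_real, Real.norm_eq_abs, norm_pow, mul_comm]
    gcongr
    exact norm_mul_ofReal_pow_le hp0 hp1 z x.2
  refine hasSum_rows_of_hasSum_cols hF (fun k => ?_) (fun j => ?_)
    (hasSum_mlSeries hq0 hq1 hp0 hp1 ((Complex.re_le_norm z).trans_lt hz))
  · have h := Complex.hasSum_ofReal.2 (hasSum_mlPoleCoeff_mul_pow hq0 hq1 (p ^ k))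
    refine (h.mul_right (z ^ k)).congr_fun fun j => ?_
    push_cast
    ring
  · exact (hasSum_geometric_of_norm_lt_one
      ((norm_mul_ofReal_pow_le hp0 hp1 z j).trans_lt hz)).mul_left _

theorem mlSeries_zero (hq0 : 0 < q) (hq1 : q < 1) (hp0 : 0 ≤ p) (hp1 : p ≤ 1) :
    mlSeries q p 0 = 1 := by
  have h := hasSum_mlCoeff hq0 hq1 hp0 hp1 (z := 0) (by simp)
  rw [h.unique (hasSum_single 0 fun k hk => by simp [hk]), mlCoeff, pow_zero, pow_zero, mul_one,
    mul_one, div_self (qPochInf_pos hq0 hq1 hq1).ne', Complex.ofReal_one]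

end PartialFractions

section MittagLeffler

variable {q α : ℝ}

theorem isQMittagLeffler_mlSeries (hq0 : 0 < q) (hq1 : q < 1) (hα : 0 ≤ α) :
    IsQMittagLeffler q α 1 fun z => (mlSeries q (q ^ α) ↑(z * (1 - q) ^ α)).re := by
  have hp0 : 0 < q ^ α := Real.rpow_pos_of_pos hq0 α
  have hp1 : q ^ α ≤ 1 := Real.rpow_le_one hq0.le hq1.le hα
  have h1q : 0 < 1 - q := sub_pos.2 hq1
  constructor
  · intro z hz
    have hsum := hasSum_mlCoeff hq0 hq1 hp0.le hp1 (z := ↑(z * (1 - q) ^ α))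
      (by rwa [Complex.norm_real])
    rw [← ofReal_re_mlSeries] at hsum
    have hre : HasSum (fun k => mlCoeff q (q ^ α) k * (z * (1 - q) ^ α) ^ k)
        (mlSeries q (q ^ α) ↑(z * (1 - q) ^ α)).re := by
      exact_mod_cast hsum
    refine hre.congr_fun fun k => ?_
    have hnum : q ^ (α * k + 1) = q * (q ^ α) ^ k := by
      rw [Real.rpow_add_one hq0.ne', Real.rpow_mul_natCast hq0.le, mul_comm]
    have hpow : (1 - q) ^ (1 - (α * k + 1)) = (((1 - q) ^ α) ^ k)⁻¹ := by
      rw [← Real.rpow_mul_natCast h1q.le, ← Real.rpow_neg h1q.le, sub_add_cancel_right]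
    rw [qGamma, hnum, hpow, mlCoeff, mul_pow, ← div_eq_mul_inv, div_div_eq_mul_div,
      div_div_eq_mul_div]
    ring
  · intro z hz
    have hz' : ((z * (1 - q) ^ α : ℝ) : ℂ).re < 1 := by
      rw [Complex.ofReal_re, ← lt_div_iff₀ (Real.rpow_pos_of_pos h1q α), one_div,
        ← Real.rpow_neg h1q.le]
      exact hz
    have hopen : IsOpen {z : ℂ | z.re < 1} := isOpen_lt Complex.continuous_re continuous_const
    exact (((differentiableOn_mlSeries hq0 hq1 hp0.le hp1).analyticAt
      (hopen.mem_nhds hz')).re_ofReal).comp_of_eq (f := fun z : ℝ => z * (1 - q) ^ α)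
        (by fun_prop) rfl

theorem ofReal_qMittagLeffler (hq0 : 0 < q) (hq1 : q < 1) (hα : 0 ≤ α) {z : ℝ} (hz : z ≤ 0) :
    (qMittagLeffler q α 1 z : ℂ) = mlSeries q (q ^ α) ↑(z * (1 - q) ^ α) := by
  rw [(isQMittagLeffler_mlSeries hq0 hq1 hα).qMittagLeffler_eqOn hq1
    (hz.trans_lt (Real.rpow_pos_of_pos (sub_pos.2 hq1) _)), ofReal_re_mlSeries]

end MittagLeffler

section LatticeKernel

variable {q p : ℝ}

/-- The kernel of the Caputo `q`-derivative on the lattice `t q ^ n`, for `p = q ^ α` and up to the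
factor `Γ_q(1 - α) (1 - q) ^ (-α)`, which normalises its value at `n = 0` to `1`. -/
noncomputable def latticeKernel (q p : ℝ) (n : ℕ) : ℝ := qBinomTerm q 1 (q / p) n

theorem latticeKernel_zero : latticeKernel q p 0 = 1 := qBinomTerm_zero

theorem pow_mul_div_lt_one (hq0 : 0 < q) (hq1 : q < 1) (hp : q < p) (n : ℕ) :
    q ^ n * (q / p) < 1 :=
  mul_lt_one_of_nonneg_of_lt_one_right (pow_le_one₀ hq0.le hq1.le)
    (div_nonneg hq0.le (hq0.trans hp).le) ((div_lt_one (hq0.trans hp)).2 hp)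

theorem latticeKernel_pos (hq0 : 0 < q) (hq1 : q < 1) (hp : q < p) (n : ℕ) :
    0 < latticeKernel q p n := by
  rw [latticeKernel, qBinomTerm]
  exact Finset.prod_pos fun i _ => div_pos (sub_pos.2 (pow_mul_div_lt_one hq0 hq1 hp i))
    (one_sub_pow_succ_pos hq0 hq1 i)

theorem latticeKernel_antitone (hq0 : 0 < q) (hq1 : q < 1) (hp : q < p) (hp1 : p ≤ 1) :
    Antitone (latticeKernel q p) := by
  refine antitone_nat_of_succ_le fun n => ?_
  rw [latticeKernel, qBinomTerm_succ, ← latticeKernel]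
  refine mul_le_of_le_one_left (latticeKernel_pos hq0 hq1 hp n).le
    ((div_le_one (one_sub_pow_succ_pos hq0 hq1 n)).2 (sub_le_sub_left ?_ 1))
  rw [pow_succ]
  exact mul_le_mul_of_nonneg_left (le_div_self hq0.le (hq0.trans hp) hp1) (pow_pos hq0 n).le

theorem latticeKernel_le_one (hq0 : 0 < q) (hq1 : q < 1) (hp : q < p) (hp1 : p ≤ 1) (n : ℕ) :
    latticeKernel q p n ≤ 1 :=
  latticeKernel_zero (q := q) (p := p) ▸ latticeKernel_antitone hq0 hq1 hp hp1 n.zero_le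

theorem hasSum_latticeKernel_mul_pow (hq0 : 0 < q) (hq1 : q < 1) {x : ℝ} (hx : |x| < 1) :
    HasSum (fun n => latticeKernel q p n * x ^ n) (qPochInf q (x * (q / p)) / qPochInf q x) := by
  have h := hasSum_qBinomTerm (a := x * 1) (b := x * (q / p)) hq0 hq1 (by rwa [mul_one])
  rw [mul_one] at h
  refine h.congr_fun fun n => ?_
  rw [mul_comm, latticeKernel, ← qBinomTerm_mul_mul, mul_one]

theorem hasSum_latticeKernel_mul_mlCoeff (hq0 : 0 < q) (hq1 : q < 1) (hp0 : 0 < p) (hp1 : p < 1)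
    (k : ℕ) :
    HasSum (fun n => latticeKernel q p n * (p ^ (k + 1)) ^ n *
      ((1 - p ^ (k + 1)) * mlCoeff q p (k + 1))) (mlCoeff q p k) := by
  have hlt : p ^ (k + 1) < 1 := pow_lt_one₀ hp0.le hp1 k.succ_ne_zero
  have h := hasSum_latticeKernel_mul_pow (p := p) hq0 hq1
    (by rwa [abs_of_pos (pow_pos hp0 _)] : |p ^ (k + 1)| < 1)
  convert! h.mul_right ((1 - p ^ (k + 1)) * mlCoeff q p (k + 1)) using 1
  have hsplit := qPochInf_eq_prod_mul hq0 hq1 (p ^ (k + 1)) 1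
  rw [Finset.prod_range_one, pow_zero, one_mul, pow_one] at hsplit
  have hpos := qPochInf_pos hq0 hq1 hlt
  have hshift : p ^ (k + 1) * (q / p) = q * p ^ k := by
    field_simp
    ring
  rw [mlCoeff, mlCoeff, hshift, mul_div_assoc', ← hsplit]
  field_simp

theorem summable_latticeKernel_mul_mlCoeff_mul_pow (hq0 : 0 < q) (hq1 : q < 1) (hp : q < p)
    (hp1 : p < 1) {z : ℂ} (hz : ‖z‖ < 1) :
    Summable fun x : ℕ × ℕ => (latticeKernel q p x.1 : ℂ) * ((p : ℂ) ^ (x.2 + 1)) ^ x.1 *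
      ((1 - (p : ℂ) ^ (x.2 + 1)) * mlCoeff q p (x.2 + 1)) * z ^ (x.2 + 1) := by
  have hp0 : 0 < p := hq0.trans hp
  have htail := ((summable_nat_add_iff 1).2
    (hasSum_mlCoeff hq0 hq1 hp0.le hp1.le hz).summable).norm
  refine Summable.of_norm_bounded ((summable_geometric_of_lt_one hp0.le hp1).mul_of_nonneg htail
    (fun n => pow_nonneg hp0.le n) fun k => norm_nonneg _) fun x => ?_
  have hpow : p ^ (x.2 + 1) ≤ p := pow_le_of_le_one hp0.le hp1.le x.2.succ_ne_zero
  have hpow0 : 0 < p ^ (x.2 + 1) := pow_pos hp0 _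
  have hκ0 := latticeKernel_pos hq0 hq1 hp x.1
  have hκ1 := latticeKernel_le_one hq0 hq1 hp hp1.le x.1
  have hsub : ‖1 - (p : ℂ) ^ (x.2 + 1)‖ ≤ 1 := by
    rw [← Complex.ofReal_pow, ← Complex.ofReal_one, ← Complex.ofReal_sub, Complex.norm_real,
      Real.norm_of_nonneg (by linarith)]
    linarith
  calc _ = latticeKernel q p x.1 * (p ^ (x.2 + 1)) ^ x.1 * ‖1 - (p : ℂ) ^ (x.2 + 1)‖ *
        ‖(mlCoeff q p (x.2 + 1) : ℂ) * z ^ (x.2 + 1)‖ := by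
        simp only [norm_mul, norm_pow, Complex.norm_real, Real.norm_of_nonneg hκ0.le,
          Real.norm_of_nonneg hp0.le]
        ring
    _ ≤ 1 * p ^ x.1 * 1 * ‖(mlCoeff q p (x.2 + 1) : ℂ) * z ^ (x.2 + 1)‖ := by gcongr
    _ = _ := by ring

theorem hasSum_latticeKernel_mlSeries_of_norm_lt_one (hq0 : 0 < q) (hq1 : q < 1) (hp : q < p)
    (hp1 : p < 1) {z : ℂ} (hz : ‖z‖ < 1) :
    HasSum (fun n : ℕ => (latticeKernel q p n : ℂ) *
      (mlSeries q p (z * (p : ℂ) ^ n) - mlSeries q p (z * (p : ℂ) ^ (n + 1))))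
      (z * mlSeries q p z) := by
  have hp0 : 0 < p := hq0.trans hp
  have hcoeff (z : ℂ) (hz : ‖z‖ < 1) := hasSum_mlCoeff hq0 hq1 hp0.le hp1.le hz
  refine hasSum_rows_of_hasSum_cols
    (summable_latticeKernel_mul_mlCoeff_mul_pow hq0 hq1 hp hp1 hz) (fun n => ?_) (fun k => ?_)
    (mul_comm z _ ▸ (hcoeff z hz).mul_right z)
  · have hlt (n : ℕ) := (norm_mul_ofReal_pow_le hp0.le hp1.le z n).trans_lt hz
    have h := (hasSum_nat_add_iff' 1).2 ((hcoeff _ (hlt n)).sub (hcoeff _ (hlt (n + 1))))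
    simp only [Finset.sum_range_one, pow_zero, sub_self, sub_zero] at h
    refine (h.mul_left _).congr_fun fun k => ?_
    ring
  · have h := Complex.hasSum_ofReal.2 (hasSum_latticeKernel_mul_mlCoeff hq0 hq1 hp0 hp1 k)
    rw [mul_assoc, ← pow_succ]
    refine (h.mul_right (z ^ (k + 1))).congr_fun fun n => ?_
    push_cast
    rfl

theorem norm_latticeKernel_mul_mlSeries_sub_le (hq0 : 0 < q) (hq1 : q < 1) (hp : q < p)
    (hp1 : p ≤ 1) {r R : ℝ} (hr0 : 0 ≤ r) (hr1 : r < 1) {z : ℂ} (hz : z.re ≤ r) (hzR : ‖z‖ ≤ R)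
    (n : ℕ) :
    ‖(latticeKernel q p n : ℂ) *
      (mlSeries q p (z * (p : ℂ) ^ n) - mlSeries q p (z * (p : ℂ) ^ (n + 1)))‖ ≤
      mlLip q * (R / (1 - r) ^ 2) * p ^ n := by
  have hp0 : 0 < p := hq0.trans hp
  have hre := re_mul_ofReal_pow_le hp0.le hp1 hr0 hz
  have hsub : ‖z * (p : ℂ) ^ n - z * (p : ℂ) ^ (n + 1)‖ ≤ R * p ^ n := by
    have hnorm : ‖z * (p : ℂ) ^ n - z * (p : ℂ) ^ (n + 1)‖ = ‖z‖ * p ^ n * (1 - p) := by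
      rw [← Complex.norm_of_nonneg (sub_nonneg.2 hp1),
        ← Complex.norm_of_nonneg (pow_nonneg hp0.le n), ← norm_mul, ← norm_mul]
      push_cast
      ring_nf
    rw [hnorm]
    have := sub_le_self 1 hp0.le
    have := sub_nonneg.2 hp1
    have := (norm_nonneg z).trans hzR
    calc ‖z‖ * p ^ n * (1 - p) ≤ R * p ^ n * 1 := by gcongr
      _ = R * p ^ n := mul_one _
  rw [norm_mul, Complex.norm_real, Real.norm_of_nonneg (latticeKernel_pos hq0 hq1 hp n).le]
  calc latticeKernel q p n *
        ‖mlSeries q p (z * (p : ℂ) ^ n) - mlSeries q p (z * (p : ℂ) ^ (n + 1))‖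
      ≤ 1 * (mlLip q * (R * p ^ n / (1 - r) ^ 2)) := by
        have := latticeKernel_le_one hq0 hq1 hp hp1 n
        have := mlLip_nonneg (q := q)
        gcongr
        refine (norm_mlSeries_sub_le hq0 hq1 hp0.le hp1 hr0 hr1 (hre n) (hre (n + 1))).trans ?_
        gcongr
    _ = _ := by ring

theorem differentiableOn_tsum_latticeKernel_mul (hq0 : 0 < q) (hq1 : q < 1) (hp : q < p)
    (hp1 : p < 1) {r R : ℝ} (hr0 : 0 ≤ r) (hr1 : r < 1) :
    DifferentiableOn ℂ (fun z => ∑' n : ℕ, (latticeKernel q p n : ℂ) *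
      (mlSeries q p (z * (p : ℂ) ^ n) - mlSeries q p (z * (p : ℂ) ^ (n + 1))))
      ({z | z.re < r} ∩ Metric.ball 0 R) := by
  have hp0 : 0 < p := hq0.trans hp
  have hcomp (n : ℕ) : DifferentiableOn ℂ (fun z => mlSeries q p (z * (p : ℂ) ^ n))
      ({z | z.re < r} ∩ Metric.ball 0 R) :=
    (differentiableOn_mlSeries hq0 hq1 hp0.le hp1.le).comp (by fun_prop) fun z hz =>
      (re_mul_ofReal_pow_le hp0.le hp1.le hr0 (le_of_lt hz.1) n).trans_lt hr1
  exact Complex.differentiableOn_tsum_of_summable_norm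
    ((summable_geometric_of_lt_one hp0.le hp1).mul_left (mlLip q * (R / (1 - r) ^ 2)))
    (fun n => ((hcomp n).sub (hcomp (n + 1))).const_mul _)
    ((isOpen_lt Complex.continuous_re continuous_const).inter Metric.isOpen_ball)
    fun n z hz => norm_latticeKernel_mul_mlSeries_sub_le hq0 hq1 hp hp1.le hr0 hr1
      (le_of_lt hz.1) (mem_ball_zero_iff.1 hz.2).le n

-- Both sides are holomorphic for `Re z < 1`, so the identity extends from the unit disc.
theorem hasSum_latticeKernel_mlSeries (hq0 : 0 < q) (hq1 : q < 1) (hp : q < p)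
    (hp1 : p < 1) {z : ℂ} (hz : z.re < 1) :
    HasSum (fun n : ℕ => (latticeKernel q p n : ℂ) *
      (mlSeries q p (z * (p : ℂ) ^ n) - mlSeries q p (z * (p : ℂ) ^ (n + 1))))
      (z * mlSeries q p z) := by
  have hp0 : 0 < p := hq0.trans hp
  obtain ⟨r, hzr, hr1⟩ := exists_between (max_lt hz one_pos)
  obtain ⟨hzr, hr0⟩ := max_lt_iff.1 hzr
  set U : Set ℂ := {w | w.re < r} ∩ Metric.ball 0 (‖z‖ + 1)
  have hUopen : IsOpen U :=
    (isOpen_lt Complex.continuous_re continuous_const).inter Metric.isOpen_ball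
  have hUconn : IsPreconnected U :=
    ((convex_halfSpace_re_lt r).inter (convex_ball 0 _)).isPreconnected
  have h0U : (0 : ℂ) ∈ U := ⟨hr0, Metric.mem_ball_self (by positivity)⟩
  have hzU : z ∈ U := ⟨hzr, by simp⟩
  have hleft := differentiableOn_tsum_latticeKernel_mul hq0 hq1 hp hp1 (R := ‖z‖ + 1) hr0.le hr1
  have hright : DifferentiableOn ℂ (fun w => w * mlSeries q p w) U :=
    differentiableOn_id.mul ((differentiableOn_mlSeries hq0 hq1 hp0.le hp1.le).mono
      fun w hw => lt_trans hw.1 hr1)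
  have hsummable := Summable.of_norm_bounded
    ((summable_geometric_of_lt_one hp0.le hp1).mul_left _)
    (norm_latticeKernel_mul_mlSeries_sub_le hq0 hq1 hp hp1.le hr0.le hr1 hzr.le le_rfl)
  refine (hleft.analyticOnNhd hUopen).eqOn_of_preconnected_of_eventuallyEq
    (hright.analyticOnNhd hUopen) hUconn h0U ?_ hzU ▸ hsummable.hasSum
  filter_upwards [Metric.ball_mem_nhds (0 : ℂ) one_pos] with w hw
  exact (hasSum_latticeKernel_mlSeries_of_norm_lt_one hq0 hq1 hp hp1
    (mem_ball_zero_iff.1 hw)).tsum_eq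

end LatticeKernel

section MaximumPrinciple

variable {E : Type*} [NormedAddCommGroup E] [NormedSpace ℝ E] {K : ℕ → ℝ} {a : ℕ → E}

theorem sum_range_smul_sub_succ (K : ℕ → ℝ) (a : ℕ → E) (N : ℕ) :
    ∑ j ∈ Finset.range N, K j • (a j - a (j + 1)) =
      K 0 • a 0 - ∑ j ∈ Finset.range N, (K j - K (j + 1)) • a (j + 1) - K N • a N := by
  induction N with
  | zero => simp
  | succ N ih =>
    rw [Finset.sum_range_succ, Finset.sum_range_succ, ih, sub_smul, smul_sub]
    abel

theorem norm_sub_le_of_hasSum_antitone_smul (hK : Antitone K) (hK0 : ∀ n, 0 ≤ K n) {s : E} {M : ℝ}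
    (hM : ∀ j, ‖a (j + 1)‖ ≤ M) (h : HasSum (fun j => K j • (a j - a (j + 1))) s) :
    ‖s - K 0 • a 0‖ ≤ K 0 * M := by
  refine le_of_tendsto' ((h.tendsto_sum_nat.comp (tendsto_add_atTop_nat 1)).sub_const _).norm
    fun N => ?_
  have hdiff (j : ℕ) : ‖(K j - K (j + 1)) • a (j + 1)‖ ≤ (K j - K (j + 1)) * M := by
    have hnonneg := sub_nonneg.2 (hK j.le_succ)
    rw [norm_smul, Real.norm_of_nonneg hnonneg]
    exact mul_le_mul_of_nonneg_left (hM j) hnonneg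
  have hlast : ‖K (N + 1) • a (N + 1)‖ ≤ K (N + 1) * M := by
    rw [norm_smul, Real.norm_of_nonneg (hK0 _)]
    exact mul_le_mul_of_nonneg_left (hM N) (hK0 _)
  rw [Function.comp_apply, sum_range_smul_sub_succ, sub_right_comm, sub_sub_cancel_left,
    ← neg_add', norm_neg]
  calc _ ≤ ∑ j ∈ Finset.range (N + 1), (K j - K (j + 1)) * M + K (N + 1) * M :=
        (norm_add_le _ _).trans (add_le_add (norm_sum_le_of_le _ fun j _ => hdiff j) hlast)
    _ = K 0 * M := by
        rw [← Finset.sum_mul, Finset.sum_range_sub']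
        ring

theorem mul_norm_le_of_hasSum_antitone_smul (hK : Antitone K) (hK0 : ∀ n, 0 ≤ K n) {c M : ℝ}
    (hc : 0 ≤ c) (hM : ∀ j, ‖a (j + 1)‖ ≤ M)
    (h : HasSum (fun j => K j • (a j - a (j + 1))) (-c • a 0)) :
    (K 0 + c) * ‖a 0‖ ≤ K 0 * M := by
  have hle := norm_sub_le_of_hasSum_antitone_smul hK hK0 hM h
  rwa [← sub_smul, norm_smul, ← neg_add', norm_neg, add_comm c,
    Real.norm_of_nonneg (add_nonneg (hK0 0) hc)] at hle

-- A bound valid from the index `n + 1` on extends to `n`, so bounds near the limit descend to `0`.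
theorem norm_le_norm_limit_of_hasSum_antitone_smul (hK : Antitone K) (hK0 : ∀ n, 0 < K n) {ℓ : E}
    {c : ℕ → ℝ} (hc : ∀ n, 0 ≤ c n) (ha : Tendsto a atTop (𝓝 ℓ))
    (h : ∀ n, HasSum (fun j => K j • (a (n + j) - a (n + j + 1))) (-c n • a n)) (n : ℕ) :
    ‖a n‖ ≤ ‖ℓ‖ := by
  refine le_of_forall_pos_le_add fun ε hε => ?_
  obtain ⟨N, hN⟩ := eventually_atTop.1
    (ha.norm.eventually_le_const (lt_add_of_pos_right ‖ℓ‖ hε))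
  have hdescend (k : ℕ) : ∀ n, N ≤ n + k → ‖a n‖ ≤ ‖ℓ‖ + ε := by
    induction k with
    | zero => exact hN
    | succ k ih =>
      intro n hn
      have hmul := mul_norm_le_of_hasSum_antitone_smul (a := fun j => a (n + j)) hK
        (fun n => (hK0 n).le) (hc n) (fun j => ih (n + (j + 1)) (by omega)) (h n)
      have hcn := mul_nonneg (hc n) (norm_nonneg (a n))
      rw [add_zero] at hmul
      exact le_of_mul_le_mul_left (by linarith) (hK0 0)
  exact hdescend N n (Nat.le_add_left N n)

theorem mul_norm_le_norm_limit_of_hasSum_antitone_smul (hK : Antitone K) (hK0 : ∀ n, 0 < K n)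
    {ℓ : E} {c : ℕ → ℝ} (hc : ∀ n, 0 ≤ c n) (ha : Tendsto a atTop (𝓝 ℓ))
    (h : ∀ n, HasSum (fun j => K j • (a (n + j) - a (n + j + 1))) (-c n • a n)) :
    (K 0 + c 0) * ‖a 0‖ ≤ K 0 * ‖ℓ‖ := by
  refine mul_norm_le_of_hasSum_antitone_smul hK (fun n => (hK0 n).le) (hc 0)
    (fun j => norm_le_norm_limit_of_hasSum_antitone_smul hK hK0 hc ha h _) ?_
  simpa only [zero_add] using h 0

end MaximumPrinciple

/-! ### The Caputo derivative on the lattice -/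

section CaputoKernel

variable {q p α t : ℝ}

theorem qPochInf_div_qPochInf (hq0 : 0 < q) (hq1 : q < 1) (hp : q < p) (n : ℕ) :
    qPochInf q (q ^ (n + 1)) / qPochInf q (p⁻¹ * q ^ (n + 1)) =
      latticeKernel q p n * (qPochInf q q / qPochInf q (q / p)) := by
  have hden : (∏ i ∈ Finset.range n, (1 - q ^ i * (q / p))) ≠ 0 :=
    (Finset.prod_pos fun i _ => sub_pos.2 (pow_mul_div_lt_one hq0 hq1 hp i)).ne'
  have hnum : (∏ i ∈ Finset.range n, (1 - q ^ (i + 1))) ≠ 0 :=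
    (Finset.prod_pos fun i _ => one_sub_pow_succ_pos hq0 hq1 i).ne'
  have hshift : p⁻¹ * q ^ (n + 1) = q ^ n * (q / p) := by ring
  rw [hshift, pow_succ, latticeKernel, qBinomTerm, Finset.prod_div_distrib,
    qPochInf_eq_prod_mul hq0 hq1 q n, qPochInf_eq_prod_mul hq0 hq1 (q / p) n]
  simp only [← pow_succ]
  generalize ∏ i ∈ Finset.range n, (1 - q ^ i * (q / p)) = A at hden ⊢
  generalize ∏ i ∈ Finset.range n, (1 - q ^ (i + 1)) = B at hnum ⊢
  field_simp

theorem natCeil_eq_one (hα0 : 0 < α) (hα1 : α < 1) : ⌈α⌉₊ = 1 := by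
  rw [Nat.ceil_eq_iff one_ne_zero]
  simpa using ⟨hα0, hα1.le⟩

theorem lt_rpow_of_lt_one (hq0 : 0 < q) (hq1 : q < 1) (hα1 : α < 1) : q < q ^ α := by
  simpa using Real.rpow_lt_rpow_of_exponent_gt hq0 hq1 hα1

theorem qGamma_one_sub_pos (hq0 : 0 < q) (hq1 : q < 1) (hα1 : α < 1) : 0 < qGamma q (1 - α) :=
  mul_pos (div_pos (qPochInf_pos hq0 hq1 hq1) (qPochInf_pos hq0 hq1
    (Real.rpow_lt_one hq0.le hq1 (sub_pos.2 hα1)))) (Real.rpow_pos_of_pos (sub_pos.2 hq1) _)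

/-- The step `(t - q t) ^ α` between `t` and `q t`, in the time scale `t ^ α`: the natural unit for
increments and for the equation on the lattice `t q ^ n`. -/
noncomputable def qStep (q α t : ℝ) : ℝ := ((1 - q) * t) ^ α

theorem qStep_zero (hα0 : 0 < α) : qStep q α 0 = 0 := by
  rw [qStep, mul_zero, Real.zero_rpow hα0.ne']

theorem qStep_pos (hq1 : q < 1) (ht : 0 < t) : 0 < qStep q α t :=
  Real.rpow_pos_of_pos (mul_pos (sub_pos.2 hq1) ht) α

theorem qStep_nonneg (hq1 : q < 1) (ht : 0 ≤ t) : 0 ≤ qStep q α t :=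
  Real.rpow_nonneg (mul_nonneg (sub_nonneg.2 hq1.le) ht) α

theorem qStep_mul_pow (hq0 : 0 < q) (hq1 : q < 1) (ht : 0 ≤ t) (n : ℕ) :
    qStep q α (t * q ^ n) = qStep q α t * (q ^ α) ^ n := by
  rw [qStep, ← mul_assoc, Real.mul_rpow (mul_nonneg (sub_nonneg.2 hq1.le) ht) (pow_pos hq0 n).le,
    qStep, ← Real.rpow_natCast_mul hq0.le, mul_comm (n : ℝ), ← Real.rpow_mul_natCast hq0.le]

theorem qKernel_mul_pow (hq0 : 0 < q) (hq1 : q < 1) (hα1 : α < 1) (ht : 0 < t) (n : ℕ) :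
    qKernel q (1 - α) t (t * q ^ n) =
      qGamma q (1 - α) / qStep q α t * latticeKernel q (q ^ α) n := by
  have h1q := sub_pos.2 hq1
  have hpow : q ^ (1 - α - 1) = (q ^ α)⁻¹ := by rw [← Real.rpow_neg hq0.le]; ring_nf
  have hq : q / q ^ α = q ^ (1 - α) := by rw [Real.rpow_sub hq0, Real.rpow_one]
  have harg : q * (t * q ^ n) / t = q ^ (n + 1) := by
    field_simp
    ring
  rw [qKernel, harg, hpow, qPochInf_div_qPochInf hq0 hq1 (lt_rpow_of_lt_one hq0 hq1 hα1), hq,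
    qGamma, qStep, Real.mul_rpow h1q.le ht.le, sub_sub_cancel, sub_sub_cancel_left,
    Real.rpow_neg ht.le]
  have := (Real.rpow_pos_of_pos h1q α).ne'
  field_simp

end CaputoKernel

section Caputo

variable {𝕜 : Type*} [RCLike 𝕜] {E : Type*} [AddCommGroup E] [Module 𝕜 E] {q α t : ℝ}

variable (𝕜) in
/-- The increments of `u` on the lattice `t q ^ n`, weighted by the Caputo kernel; up to a scalar
these are the terms of the Jackson sum of the Caputo derivative. -/
noncomputable def kernelTerm (q α : ℝ) (u : ℝ → E) (t : ℝ) (n : ℕ) : E :=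
  ((latticeKernel q (q ^ α) n : ℝ) : 𝕜) • (u (t * q ^ n) - u (t * q ^ (n + 1)))

theorem caputoTerm_eq_smul_kernelTerm (hq0 : 0 < q) (hq1 : q < 1) (hα0 : 0 < α) (hα1 : α < 1)
    (ht : 0 < t) (u : ℝ → E) (n : ℕ) :
    caputoTerm 𝕜 q α u t n =
      ((qGamma q (1 - α) / qStep q α t / ((1 - q) * t) : ℝ) : 𝕜) • kernelTerm 𝕜 q α u t n := by
  have hnext : q * (t * q ^ n) = t * q ^ (n + 1) := by ring
  rw [caputoTerm, jacksonTerm, rlIntegrand, natCeil_eq_one hα0 hα1, Nat.cast_one,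
    qKernel_mul_pow hq0 hq1 hα1 ht, Function.iterate_one, qDeriv, kernelTerm, hnext, smul_smul,
    smul_smul, smul_smul]
  congr 1
  have := (pow_pos hq0 n).ne'
  norm_cast
  field_simp

theorem caputoTerm_scale_pos (hq0 : 0 < q) (hq1 : q < 1) (hα1 : α < 1) (ht : 0 < t) :
    0 < qGamma q (1 - α) / qStep q α t / ((1 - q) * t) :=
  div_pos (div_pos (qGamma_one_sub_pos hq0 hq1 hα1) (qStep_pos hq1 ht))
    (mul_pos (sub_pos.2 hq1) ht)

variable [TopologicalSpace E] [ContinuousConstSMul 𝕜 E]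

theorem summable_caputoTerm_iff (hq0 : 0 < q) (hq1 : q < 1) (hα0 : 0 < α) (hα1 : α < 1)
    (ht : 0 < t) (u : ℝ → E) :
    Summable (caputoTerm 𝕜 q α u t) ↔ Summable (kernelTerm 𝕜 q α u t) := by
  have hscale := RCLike.ofReal_ne_zero (K := 𝕜).2 (caputoTerm_scale_pos hq0 hq1 hα1 ht).ne'
  rw [funext (caputoTerm_eq_smul_kernelTerm hq0 hq1 hα0 hα1 ht u)]
  generalize ((qGamma q (1 - α) / qStep q α t / ((1 - q) * t) : ℝ) : 𝕜) = c at hscale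
  exact ⟨fun h => by simpa only [inv_smul_smul₀ hscale] using h.const_smul c⁻¹,
    fun h => h.const_smul c⟩

variable [T2Space E]

theorem caputo_eq_smul_tsum_kernelTerm (hq0 : 0 < q) (hq1 : q < 1) (hα0 : 0 < α) (hα1 : α < 1)
    (ht : 0 < t) (u : ℝ → E) :
    caputo 𝕜 q α u t = (((qStep q α t)⁻¹ : ℝ) : 𝕜) • ∑' n, kernelTerm 𝕜 q α u t n := by
  have hceil : ((⌈α⌉₊ : ℝ) - α) = 1 - α := by rw [natCeil_eq_one hα0 hα1, Nat.cast_one]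
  have hterm := caputoTerm_eq_smul_kernelTerm (𝕜 := 𝕜) hq0 hq1 hα0 hα1 ht u
  simp only [caputoTerm] at hterm
  rw [caputo, rlIntegral, jacksonIntegral, tsum_congr hterm, tsum_const_smul'', hceil, smul_smul,
    smul_smul]
  congr 1
  have := (qGamma_one_sub_pos hq0 hq1 hα1).ne'
  have := (sub_pos.2 hq1).ne'
  norm_cast
  field_simp

theorem caputo_eq_of_hasSum (hq0 : 0 < q) (hq1 : q < 1) (hα0 : 0 < α) (hα1 : α < 1)
    (ht : 0 < t) {u : ℝ → E} {s : E}
    (h : HasSum (kernelTerm 𝕜 q α u t) ((qStep q α t : 𝕜) • s)) : caputo 𝕜 q α u t = s := by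
  rw [caputo_eq_smul_tsum_kernelTerm hq0 hq1 hα0 hα1 ht, h.tsum_eq, RCLike.ofReal_inv,
    inv_smul_smul₀ (RCLike.ofReal_ne_zero.2 (qStep_pos hq1 ht).ne')]

theorem hasSum_kernelTerm_of_summable (hq0 : 0 < q) (hq1 : q < 1) (hα0 : 0 < α)
    (hα1 : α < 1) (ht : 0 < t) {u : ℝ → E} (h : Summable (caputoTerm 𝕜 q α u t)) :
    HasSum (kernelTerm 𝕜 q α u t) ((qStep q α t : 𝕜) • caputo 𝕜 q α u t) := by
  rw [caputo_eq_smul_tsum_kernelTerm hq0 hq1 hα0 hα1 ht, RCLike.ofReal_inv,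
    smul_inv_smul₀ (RCLike.ofReal_ne_zero.2 (qStep_pos hq1 ht).ne')]
  exact ((summable_caputoTerm_iff hq0 hq1 hα0 hα1 ht u).1 h).hasSum

end Caputo

section Mode

variable {q α : ℝ}

theorem mul_pow_mem_Ioc {t T : ℝ} (hq0 : 0 < q) (hq1 : q < 1) (ht : t ∈ Ioc 0 T) (n : ℕ) :
    t * q ^ n ∈ Ioc 0 T :=
  ⟨mul_pos ht.1 (pow_pos hq0 n),
    (mul_le_of_le_one_right ht.1.le (pow_le_one₀ hq0.le hq1.le)).trans ht.2⟩

theorem tendsto_geometric_rpow (hq0 : 0 < q) (hq1 : q < 1) (hα0 : 0 < α) (c : ℝ) :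
    Tendsto (fun n : ℕ => c * (q ^ α) ^ n) atTop (𝓝 0) := by
  simpa only [mul_zero] using (tendsto_pow_atTop_nhds_zero_of_lt_one (Real.rpow_nonneg hq0.le α)
    (Real.rpow_lt_one hq0.le hq1 hα0)).const_mul c

/-- The Mittag-Leffler function `t ↦ e_{α, 1}(-μ t ^ α; q)`: the solution of `ᶜD_q^α v + μ v = 0`,
`v(0) = 1`. -/
noncomputable def mlMode (q α μ t : ℝ) : ℝ := qMittagLeffler q α 1 (-μ * t ^ α)

theorem ofReal_mlMode (hq0 : 0 < q) (hq1 : q < 1) (hα0 : 0 < α) {μ t : ℝ} (hμ : 0 ≤ μ)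
    (ht : 0 ≤ t) :
    (mlMode q α μ t : ℂ) = mlSeries q (q ^ α) ((-(μ * qStep q α t) : ℝ) : ℂ) := by
  have hnonpos : -μ * t ^ α ≤ 0 :=
    mul_nonpos_of_nonpos_of_nonneg (neg_nonpos.2 hμ) (Real.rpow_nonneg ht α)
  rw [mlMode, ofReal_qMittagLeffler hq0 hq1 hα0.le hnonpos, qStep,
    Real.mul_rpow (sub_nonneg.2 hq1.le) ht]
  ring_nf

theorem mlMode_zero (hq0 : 0 < q) (hq1 : q < 1) (hα0 : 0 < α) {μ : ℝ} (hμ : 0 ≤ μ) :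
    mlMode q α μ 0 = 1 := by
  have h := ofReal_mlMode hq0 hq1 hα0 hμ le_rfl
  rw [qStep_zero hα0, mul_zero, neg_zero, Complex.ofReal_zero, mlSeries_zero hq0 hq1
    (Real.rpow_nonneg hq0.le α) (Real.rpow_le_one hq0.le hq1.le hα0.le)] at h
  exact_mod_cast h

theorem abs_mlMode_sub_le (hq0 : 0 < q) (hq1 : q < 1) (hα0 : 0 < α) {μ s t : ℝ} (hμ : 0 ≤ μ)
    (hs : 0 ≤ s) (ht : 0 ≤ t) :
    |mlMode q α μ s - mlMode q α μ t| ≤ mlLip q * μ * |qStep q α s - qStep q α t| := by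
  have hnonpos {r : ℝ} (hr : 0 ≤ r) : (((-(μ * qStep q α r) : ℝ) : ℂ)).re ≤ 0 :=
    neg_nonpos.2 (mul_nonneg hμ (qStep_nonneg hq1 hr))
  have h := norm_mlSeries_sub_le hq0 hq1 (Real.rpow_nonneg hq0.le α)
    (Real.rpow_le_one hq0.le hq1.le hα0.le) le_rfl one_pos (hnonpos hs) (hnonpos ht)
  rw [← ofReal_mlMode hq0 hq1 hα0 hμ hs, ← ofReal_mlMode hq0 hq1 hα0 hμ ht,
    ← Complex.ofReal_sub, ← Complex.ofReal_sub, Complex.norm_real, Complex.norm_real,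
    neg_sub_neg, ← mul_sub, norm_mul, Real.norm_of_nonneg hμ, norm_sub_rev (qStep q α t)] at h
  simpa [mul_assoc] using h

theorem tendsto_mlMode (hq0 : 0 < q) (hq1 : q < 1) (hα0 : 0 < α) {μ t : ℝ} (hμ : 0 ≤ μ)
    (ht : 0 ≤ t) : Tendsto (fun n : ℕ => mlMode q α μ (t * q ^ n)) atTop (𝓝 1) := by
  refine tendsto_iff_norm_sub_tendsto_zero.2 (squeeze_zero (fun _ => norm_nonneg _) (fun n => ?_)
    (tendsto_geometric_rpow hq0 hq1 hα0 (mlLip q * μ * qStep q α t)))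
  have htn := mul_nonneg ht (pow_pos hq0 n).le
  have h := abs_mlMode_sub_le hq0 hq1 hα0 hμ htn le_rfl
  rwa [mlMode_zero hq0 hq1 hα0 hμ, qStep_zero hα0, sub_zero, abs_of_nonneg (qStep_nonneg hq1 htn),
    qStep_mul_pow hq0 hq1 ht, ← mul_assoc] at h

theorem hasSum_latticeKernel_mul_mlMode_sub (hq0 : 0 < q) (hq1 : q < 1) (hα0 : 0 < α)
    (hα1 : α < 1) {μ t : ℝ} (hμ : 0 ≤ μ) (ht : 0 ≤ t) :
    HasSum (fun n : ℕ => latticeKernel q (q ^ α) n *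
      (mlMode q α μ (t * q ^ n) - mlMode q α μ (t * q ^ (n + 1))))
      (-(μ * qStep q α t) * mlMode q α μ t) := by
  have hnonpos : -(μ * qStep q α t) ≤ 0 := neg_nonpos.2 (mul_nonneg hμ (qStep_nonneg hq1 ht))
  have hmode (n : ℕ) : (mlMode q α μ (t * q ^ n) : ℂ) =
      mlSeries q (q ^ α) (((-(μ * qStep q α t) : ℝ) : ℂ) * ((q ^ α : ℝ) : ℂ) ^ n) := by
    rw [ofReal_mlMode hq0 hq1 hα0 hμ (mul_nonneg ht (pow_pos hq0 n).le),
      qStep_mul_pow hq0 hq1 ht]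
    push_cast
    ring_nf
  have h := hasSum_latticeKernel_mlSeries hq0 hq1 (lt_rpow_of_lt_one hq0 hq1 hα1)
    (Real.rpow_lt_one hq0.le hq1 hα0)
    (show ((-(μ * qStep q α t) : ℝ) : ℂ).re < 1 from hnonpos.trans_lt one_pos)
  simp only [← hmode, ← ofReal_mlMode hq0 hq1 hα0 hμ ht] at h
  exact_mod_cast h

theorem mul_abs_mlMode_le_one (hq0 : 0 < q) (hq1 : q < 1) (hα0 : 0 < α) (hα1 : α < 1) {μ t : ℝ}
    (hμ : 0 ≤ μ) (ht : 0 ≤ t) : (1 + μ * qStep q α t) * |mlMode q α μ t| ≤ 1 := by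
  have hp := lt_rpow_of_lt_one hq0 hq1 hα1
  have htn (n : ℕ) : 0 ≤ t * q ^ n := mul_nonneg ht (pow_pos hq0 n).le
  have h := mul_norm_le_norm_limit_of_hasSum_antitone_smul
    (latticeKernel_antitone hq0 hq1 hp (Real.rpow_le_one hq0.le hq1.le hα0.le))
    (latticeKernel_pos hq0 hq1 hp) (a := fun n => mlMode q α μ (t * q ^ n))
    (c := fun n => μ * qStep q α (t * q ^ n))
    (fun n => mul_nonneg hμ (qStep_nonneg hq1 (htn n))) (tendsto_mlMode hq0 hq1 hα0 hμ ht)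
    (fun n => by simpa only [smul_eq_mul, pow_add, mul_assoc] using
      hasSum_latticeKernel_mul_mlMode_sub hq0 hq1 hα0 hα1 hμ (htn n))
  simpa [latticeKernel_zero] using h

theorem abs_mlMode_le_one (hq0 : 0 < q) (hq1 : q < 1) (hα0 : 0 < α) (hα1 : α < 1) {μ t : ℝ}
    (hμ : 0 ≤ μ) (ht : 0 ≤ t) : |mlMode q α μ t| ≤ 1 :=
  (le_mul_of_one_le_left (abs_nonneg _)
    (le_add_of_nonneg_right (mul_nonneg hμ (qStep_nonneg hq1 ht)))).trans
    (mul_abs_mlMode_le_one hq0 hq1 hα0 hα1 hμ ht)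

/-- A lower bound of `1 - e_{α, 1}(-μ T ^ α; q)` that is uniform in `μ ≥ m`. -/
noncomputable def modeGap (q α m T : ℝ) : ℝ := m * qStep q α T / (1 + m * qStep q α T)

theorem modeGap_pos (hq1 : q < 1) {m T : ℝ} (hm : 0 < m) (hT : 0 < T) : 0 < modeGap q α m T := by
  have := qStep_pos (α := α) hq1 hT
  rw [modeGap]
  positivity

theorem modeGap_le (hq0 : 0 < q) (hq1 : q < 1) (hα0 : 0 < α) (hα1 : α < 1) {m μ T : ℝ}
    (hm : 0 < m) (hμ : m ≤ μ) (hT : 0 < T) : modeGap q α m T ≤ 1 - mlMode q α μ T := by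
  have hmT : 0 < m * qStep q α T := mul_pos hm (qStep_pos hq1 hT)
  have hmul : (1 + m * qStep q α T) * |mlMode q α μ T| ≤ 1 :=
    (mul_le_mul_of_nonneg_right (by have := qStep_pos (α := α) hq1 hT; gcongr)
      (abs_nonneg _)).trans (mul_abs_mlMode_le_one hq0 hq1 hα0 hα1 (hm.le.trans hμ) hT.le)
  have hle : (1 + m * qStep q α T) * mlMode q α μ T ≤ 1 :=
    (mul_le_mul_of_nonneg_left (le_abs_self _) (by linarith)).trans hmul
  rw [modeGap, div_le_iff₀ (by linarith)]
  linarith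

theorem one_sub_mlMode_pos (hq0 : 0 < q) (hq1 : q < 1) (hα0 : 0 < α) (hα1 : α < 1) {μ T : ℝ}
    (hμ : 0 < μ) (hT : 0 < T) : 0 < 1 - mlMode q α μ T :=
  (modeGap_pos hq1 hμ hT).trans_le (modeGap_le hq0 hq1 hα0 hα1 hμ le_rfl hT)

end Mode

section ScalarUniqueness

variable {𝕜 : Type*} [RCLike 𝕜] {q α μ T : ℝ} {v : ℝ → 𝕜} {h : 𝕜}

-- The maximum principle for the difference of `v` and the stationary solution `h / μ`.
theorem mul_norm_sub_div_le_of_hasSum_kernelTerm (hq0 : 0 < q) (hq1 : q < 1) (hα0 : 0 < α)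
    (hα1 : α < 1) (hμ : 0 < μ) {t : ℝ} (ht : 0 < t)
    (hv : Tendsto (fun n : ℕ => v (t * q ^ n)) atTop (𝓝 0))
    (heq : ∀ n : ℕ, HasSum (kernelTerm 𝕜 q α v (t * q ^ n))
      ((qStep q α (t * q ^ n) : 𝕜) * (h - (μ : 𝕜) * v (t * q ^ n)))) :
    (1 + μ * qStep q α t) * ‖v t - h / (μ : 𝕜)‖ ≤ ‖h / (μ : 𝕜)‖ := by
  have hp := lt_rpow_of_lt_one hq0 hq1 hα1
  have hμ' : (μ : 𝕜) ≠ 0 := RCLike.ofReal_ne_zero.2 hμ.ne'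
  have hshift (n : ℕ) : HasSum (fun j => latticeKernel q (q ^ α) j •
      ((v (t * q ^ (n + j)) - h / (μ : 𝕜)) - (v (t * q ^ (n + j + 1)) - h / (μ : 𝕜))))
      (-(μ * qStep q α (t * q ^ n)) • (v (t * q ^ n) - h / (μ : 𝕜))) := by
    convert! heq n using 1
    · funext j
      rw [kernelTerm, RCLike.real_smul_eq_coe_smul (K := 𝕜), sub_sub_sub_cancel_right]
      simp only [pow_add, mul_assoc]
    · rw [RCLike.real_smul_eq_coe_mul]
      push_cast
      field_simp
      ring
  have hmax := mul_norm_le_norm_limit_of_hasSum_antitone_smul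
    (latticeKernel_antitone hq0 hq1 hp (Real.rpow_le_one hq0.le hq1.le hα0.le))
    (latticeKernel_pos hq0 hq1 hp) (c := fun n => μ * qStep q α (t * q ^ n))
    (fun n => mul_nonneg hμ.le (qStep_nonneg hq1 (mul_pos ht (pow_pos hq0 n)).le))
    (hv.sub_const (h / (μ : 𝕜))) hshift
  simpa [latticeKernel_zero] using hmax

theorem eq_zero_of_hasSum_kernelTerm (hq0 : 0 < q) (hq1 : q < 1) (hα0 : 0 < α)
    (hα1 : α < 1) (hμ : 0 < μ) (hT : 0 < T)
    (hv : ∀ t ∈ Ioc 0 T, Tendsto (fun n : ℕ => v (t * q ^ n)) atTop (𝓝 0))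
    (heq : ∀ t ∈ Ioc 0 T,
      HasSum (kernelTerm 𝕜 q α v t) ((qStep q α t : 𝕜) * (h - (μ : 𝕜) * v t)))
    (hvT : v T = 0) : h = 0 ∧ ∀ t ∈ Ioc 0 T, v t = 0 := by
  have hbound (t : ℝ) (ht : t ∈ Ioc 0 T) :=
    mul_norm_sub_div_le_of_hasSum_kernelTerm hq0 hq1 hα0 hα1 hμ ht.1 (hv t ht)
      fun n => heq _ (mul_pow_mem_Ioc hq0 hq1 ht n)
  have hdiv : h / (μ : 𝕜) = 0 := by
    have hle := hbound T ⟨hT, le_rfl⟩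
    have hμT := mul_pos hμ (qStep_pos (α := α) hq1 hT)
    rw [hvT, zero_sub, norm_neg] at hle
    exact norm_le_zero_iff.1 (nonpos_of_mul_nonpos_right (by linarith) hμT)
  refine ⟨(div_eq_zero_iff.1 hdiv).resolve_right (RCLike.ofReal_ne_zero.2 hμ.ne'), fun t ht => ?_⟩
  have hle := hbound t ht
  rw [hdiv, sub_zero, norm_zero] at hle
  exact norm_le_zero_iff.1 (nonpos_of_mul_nonpos_right hle
    (add_pos_of_pos_of_nonneg one_pos (mul_nonneg hμ.le (qStep_nonneg hq1 ht.1.le))))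

end ScalarUniqueness

/-! ### The Sobolev scale -/

section Sobolev

variable {ι 𝕜 𝕜' : Type*} [RCLike 𝕜] [RCLike 𝕜'] {lam : ι → ℝ} {s s' : ℝ}

theorem sobolevNorm_nonneg (lam : ι → ℝ) (s : ℝ) (a : ι → 𝕜) : 0 ≤ sobolevNorm lam s a :=
  Real.sqrt_nonneg _

theorem sobolevWeight_pos (hlam : ∀ k, 0 ≤ lam k) (s : ℝ) (k : ι) : 0 < (1 + lam k) ^ s :=
  Real.rpow_pos_of_pos (add_pos_of_pos_of_nonneg one_pos (hlam k)) s

theorem sobolevTerm_nonneg (hlam : ∀ k, 0 ≤ lam k) (s : ℝ) (a : ι → 𝕜) (k : ι) :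
    0 ≤ (1 + lam k) ^ s * ‖a k‖ ^ 2 :=
  mul_nonneg (sobolevWeight_pos hlam s k).le (sq_nonneg _)

theorem sobolevNorm_sq (hlam : ∀ k, 0 ≤ lam k) (s : ℝ) (a : ι → 𝕜) :
    sobolevNorm lam s a ^ 2 = ∑' k, (1 + lam k) ^ s * ‖a k‖ ^ 2 :=
  Real.sq_sqrt (tsum_nonneg (sobolevTerm_nonneg hlam s a))

theorem MemSobolev.of_term_le (hlam : ∀ k, 0 ≤ lam k) {b : ι → 𝕜'} (hb : MemSobolev lam s' b)
    {a : ι → 𝕜} {c : ℝ} (hc : 0 ≤ c)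
    (h : ∀ k, (1 + lam k) ^ s * ‖a k‖ ^ 2 ≤ c ^ 2 * ((1 + lam k) ^ s' * ‖b k‖ ^ 2)) :
    MemSobolev lam s a ∧ sobolevNorm lam s a ≤ c * sobolevNorm lam s' b := by
  have hcb := Summable.mul_left (c ^ 2) hb
  have ha : MemSobolev lam s a := Summable.of_nonneg_of_le (sobolevTerm_nonneg hlam s a) h hcb
  refine ⟨ha, abs_le_of_sq_le_sq' ?_ (mul_nonneg hc (sobolevNorm_nonneg _ _ _)) |>.2⟩
  rw [mul_pow, sobolevNorm_sq hlam, sobolevNorm_sq hlam, ← tsum_mul_left]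
  exact Summable.tsum_le_tsum h ha hcb

theorem MemSobolev.of_norm_le (hlam : ∀ k, 0 ≤ lam k) {b : ι → 𝕜'} (hb : MemSobolev lam s b)
    {a : ι → 𝕜} {c : ℝ} (hc : 0 ≤ c) (h : ∀ k, ‖a k‖ ≤ c * ‖b k‖) :
    MemSobolev lam s a ∧ sobolevNorm lam s a ≤ c * sobolevNorm lam s b := by
  refine hb.of_term_le hlam hc fun k => ?_
  calc (1 + lam k) ^ s * ‖a k‖ ^ 2 ≤ (1 + lam k) ^ s * (c * ‖b k‖) ^ 2 :=
        mul_le_mul_of_nonneg_left (pow_le_pow_left₀ (norm_nonneg _) (h k) 2)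
          (sobolevWeight_pos hlam s k).le
    _ = c ^ 2 * ((1 + lam k) ^ s * ‖b k‖ ^ 2) := by ring

theorem MemSobolev.of_norm_le_mul (hlam : ∀ k, 0 ≤ lam k) {b : ι → 𝕜'}
    (hb : MemSobolev lam (s + 2) b) {a : ι → 𝕜} {c : ℝ} (hc : 0 ≤ c)
    (h : ∀ k, ‖a k‖ ≤ c * ((1 + lam k) * ‖b k‖)) :
    MemSobolev lam s a ∧ sobolevNorm lam s a ≤ c * sobolevNorm lam (s + 2) b := by
  refine hb.of_term_le hlam hc fun k => ?_
  rw [Real.rpow_add (add_pos_of_pos_of_nonneg one_pos (hlam k)), Real.rpow_two]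
  calc (1 + lam k) ^ s * ‖a k‖ ^ 2 ≤ (1 + lam k) ^ s * (c * ((1 + lam k) * ‖b k‖)) ^ 2 :=
        mul_le_mul_of_nonneg_left (pow_le_pow_left₀ (norm_nonneg _) (h k) 2)
          (sobolevWeight_pos hlam s k).le
    _ = c ^ 2 * ((1 + lam k) ^ s * (1 + lam k) ^ 2 * ‖b k‖ ^ 2) := by ring

theorem MemSobolev.of_add_two (hlam : ∀ k, 0 ≤ lam k) {a : ι → 𝕜}
    (ha : MemSobolev lam (s + 2) a) :
    MemSobolev lam s a ∧ sobolevNorm lam s a ≤ sobolevNorm lam (s + 2) a := by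
  simpa only [one_mul] using ha.of_norm_le_mul hlam zero_le_one fun k => by
    simpa only [one_mul] using
      le_mul_of_one_le_left (norm_nonneg (a k)) (le_add_of_nonneg_right (hlam k))

theorem MemSobolev.seriesOp (hlam : ∀ k, 0 ≤ lam k) {a : ι → 𝕜}
    (ha : MemSobolev lam (s + 2) a) : MemSobolev lam s (seriesOp lam a) := by
  refine (ha.of_norm_le_mul hlam zero_le_one fun k => ?_).1
  rw [_root_.seriesOp, norm_mul, RCLike.norm_ofReal, abs_of_nonneg (hlam k), one_mul]
  exact mul_le_mul_of_nonneg_right (by linarith) (norm_nonneg _)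

/-- The sum of the moduli of two formal series, which dominates all their combinations with
coefficients of modulus at most `1`. -/
def majorant (a b : ι → 𝕜) : ι → ℝ := fun k => ‖a k‖ + ‖b k‖

theorem norm_majorant (a b : ι → 𝕜) (k : ι) : ‖majorant a b k‖ = ‖a k‖ + ‖b k‖ :=
  Real.norm_of_nonneg (add_nonneg (norm_nonneg _) (norm_nonneg _))

theorem sobolevTerm_majorant_le (hlam : ∀ k, 0 ≤ lam k) (s : ℝ) (a b : ι → 𝕜) (k : ι) :
    (1 + lam k) ^ s * ‖majorant a b k‖ ^ 2 ≤
      2 * ((1 + lam k) ^ s * ‖a k‖ ^ 2 + (1 + lam k) ^ s * ‖b k‖ ^ 2) := by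
  rw [norm_majorant, ← mul_add, mul_left_comm]
  exact mul_le_mul_of_nonneg_left add_sq_le (sobolevWeight_pos hlam s k).le

theorem MemSobolev.majorant (hlam : ∀ k, 0 ≤ lam k) {a b : ι → 𝕜} (ha : MemSobolev lam s a)
    (hb : MemSobolev lam s b) : MemSobolev lam s (majorant a b) :=
  Summable.of_nonneg_of_le (sobolevTerm_nonneg hlam s _) (sobolevTerm_majorant_le hlam s a b)
    ((Summable.add ha hb).mul_left 2)

theorem sobolevNorm_majorant_sq_le (hlam : ∀ k, 0 ≤ lam k) {a b : ι → 𝕜}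
    (ha : MemSobolev lam s a) (hb : MemSobolev lam s b) :
    sobolevNorm lam s (majorant a b) ^ 2 ≤
      2 * (sobolevNorm lam s a ^ 2 + sobolevNorm lam s b ^ 2) := by
  rw [sobolevNorm_sq hlam, sobolevNorm_sq hlam, sobolevNorm_sq hlam, ← Summable.tsum_add ha hb,
    ← tsum_mul_left]
  exact Summable.tsum_le_tsum (sobolevTerm_majorant_le hlam s a b) (ha.majorant hlam hb)
    ((Summable.add ha hb).mul_left 2)

theorem MemSobolev.add (hlam : ∀ k, 0 ≤ lam k) {a b : ι → 𝕜} (ha : MemSobolev lam s a)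
    (hb : MemSobolev lam s b) : MemSobolev lam s (a + b) :=
  ((ha.majorant hlam hb).of_norm_le hlam zero_le_one fun k => by
    rw [one_mul, norm_majorant]
    exact norm_add_le _ _).1

theorem MemSobolev.sub (hlam : ∀ k, 0 ≤ lam k) {a b : ι → 𝕜} (ha : MemSobolev lam s a)
    (hb : MemSobolev lam s b) : MemSobolev lam s (a - b) :=
  ((ha.majorant hlam hb).of_norm_le hlam zero_le_one fun k => by
    rw [one_mul, norm_majorant]
    exact norm_sub_le _ _).1

theorem MemSobolev.smul (hlam : ∀ k, 0 ≤ lam k) {a : ι → 𝕜} (ha : MemSobolev lam s a) (c : 𝕜) :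
    MemSobolev lam s (c • a) :=
  (ha.of_norm_le hlam (norm_nonneg c) fun _ => (norm_smul _ _).le).1

theorem MemSobolev.norm_apply_le (hlam : ∀ k, 0 ≤ lam k) {a : ι → 𝕜} (ha : MemSobolev lam s a)
    (k : ι) : ‖a k‖ ≤ (√((1 + lam k) ^ s))⁻¹ * sobolevNorm lam s a := by
  have hw := sobolevWeight_pos hlam s k
  rw [← div_eq_inv_mul, le_div_iff₀ (Real.sqrt_pos.2 hw)]
  refine Real.le_sqrt_of_sq_le ?_
  rw [mul_pow, Real.sq_sqrt hw.le, mul_comm]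
  exact Summable.le_tsum ha k fun j _ => sobolevTerm_nonneg hlam s a j

theorem summable_of_summable_sobolevNorm (hlam : ∀ k, 0 ≤ lam k) {β : Type*} {g : β → ι → 𝕜}
    (hg : ∀ n, MemSobolev lam s (g n)) (h : Summable fun n => sobolevNorm lam s (g n)) :
    Summable g :=
  Pi.summable.2 fun k => Summable.of_norm_bounded (h.mul_left _)
    fun n => (hg n).norm_apply_le hlam k

theorem tendsto_apply_of_tendsto_sobolevNorm (hlam : ∀ k, 0 ≤ lam k) {β : Type*} {l : Filter β}
    {g : β → ι → 𝕜} {a : ι → 𝕜} (hg : ∀ n, MemSobolev lam s (g n - a))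
    (h : Tendsto (fun n => sobolevNorm lam s (g n - a)) l (𝓝 0)) (k : ι) :
    Tendsto (fun n => g n k) l (𝓝 (a k)) := by
  refine tendsto_iff_norm_sub_tendsto_zero.2 (squeeze_zero (fun _ => norm_nonneg _)
    (fun n => (hg n).norm_apply_le hlam k) ?_)
  simpa only [mul_zero] using h.const_mul (√((1 + lam k) ^ s))⁻¹

end Sobolev

section CaputoSobolev

variable {ι 𝕜 : Type*} [RCLike 𝕜] {lam : ι → ℝ} {q α s t : ℝ} {u : ℝ → ι → 𝕜}

theorem MemSobolev.caputoTerm (hlam : ∀ k, 0 ≤ lam k) (hq0 : 0 < q) (hq1 : q < 1) (hα0 : 0 < α)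
    (hα1 : α < 1) (ht : 0 < t) {n : ℕ}
    (h : MemSobolev lam s (u (t * q ^ n) - u (t * q ^ (n + 1)))) :
    MemSobolev lam s (caputoTerm 𝕜 q α u t n) ∧ sobolevNorm lam s (caputoTerm 𝕜 q α u t n) ≤
      qGamma q (1 - α) / qStep q α t / ((1 - q) * t) *
        sobolevNorm lam s (u (t * q ^ n) - u (t * q ^ (n + 1))) := by
  have hp := lt_rpow_of_lt_one hq0 hq1 hα1
  have hp1 := Real.rpow_le_one hq0.le hq1.le hα0.le
  have hscale := caputoTerm_scale_pos hq0 hq1 hα1 ht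
  refine h.of_norm_le hlam hscale.le fun k => ?_
  rw [caputoTerm_eq_smul_kernelTerm hq0 hq1 hα0 hα1 ht, kernelTerm, Pi.smul_apply, Pi.smul_apply,
    norm_smul, norm_smul, RCLike.norm_ofReal, RCLike.norm_ofReal, abs_of_pos hscale,
    abs_of_pos (latticeKernel_pos hq0 hq1 hp n)]
  exact mul_le_mul_of_nonneg_left
    (mul_le_of_le_one_left (norm_nonneg _) (latticeKernel_le_one hq0 hq1 hp hp1 n)) hscale.le

theorem MemLinfty.memSobolev_caputoTerm (hlam : ∀ k, 0 ≤ lam k) (hq0 : 0 < q) (hq1 : q < 1)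
    (hα0 : 0 < α) (hα1 : α < 1) {T : ℝ} (hu : MemLinfty lam T s u) (ht : t ∈ Ioc 0 T) (n : ℕ) :
    MemSobolev lam s (caputoTerm 𝕜 q α u t n) :=
  have hmem (n : ℕ) := hu.1 _ (Ioc_subset_Icc_self (mul_pow_mem_Ioc hq0 hq1 ht n))
  (((hmem n).sub hlam (hmem (n + 1))).caputoTerm hlam hq0 hq1 hα0 hα1 ht.1).1

theorem tendsto_sobolevNorm_sub_of_le_qStep (hq0 : 0 < q) (hq1 : q < 1) (hα0 : 0 < α)
    (ht : 0 ≤ t) {A : ℝ}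
    (hA : ∀ n : ℕ, sobolevNorm lam s (u (t * q ^ n) - u 0) ≤ A * qStep q α (t * q ^ n)) :
    Tendsto (fun n : ℕ => sobolevNorm lam s (u (t * q ^ n) - u 0)) atTop (𝓝 0) := by
  refine squeeze_zero (fun _ => sobolevNorm_nonneg _ _ _) hA ?_
  simpa only [qStep_mul_pow hq0 hq1 ht, mul_assoc] using
    tendsto_geometric_rpow hq0 hq1 hα0 (A * qStep q α t)

theorem summable_sobolevNorm_caputoTerm_of_le_qStep (hlam : ∀ k, 0 ≤ lam k) (hq0 : 0 < q)
    (hq1 : q < 1) (hα0 : 0 < α) (hα1 : α < 1) (ht : 0 < t) {A : ℝ}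
    (hu : ∀ n : ℕ, MemSobolev lam s (u (t * q ^ n) - u (t * q ^ (n + 1))) ∧
      sobolevNorm lam s (u (t * q ^ n) - u (t * q ^ (n + 1))) ≤ A * qStep q α (t * q ^ n)) :
    Summable fun n : ℕ => sobolevNorm lam s (caputoTerm 𝕜 q α u t n) := by
  refine Summable.of_nonneg_of_le (fun _ => sobolevNorm_nonneg _ _ _)
    (fun n => ((hu n).1.caputoTerm hlam hq0 hq1 hα0 hα1 ht).2.trans
      (mul_le_mul_of_nonneg_left (hu n).2 (caputoTerm_scale_pos hq0 hq1 hα1 ht).le)) ?_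
  simp only [qStep_mul_pow hq0 hq1 ht.le, ← mul_assoc]
  exact (summable_geometric_of_lt_one (Real.rpow_nonneg hq0.le α)
    (Real.rpow_lt_one hq0.le hq1 hα0)).mul_left _

end CaputoSobolev

section Hilbert

variable {ι 𝕜 H : Type*} [RCLike 𝕜] [NormedAddCommGroup H] [InnerProductSpace 𝕜 H]
  {lam : ι → ℝ} (ψ : HilbertBasis ι 𝕜 H)

theorem eigenSeries_self [DecidableEq ι] (k : ι) : eigenSeries ψ (ψ k) = Pi.single k 1 := by
  funext j
  rw [eigenSeries, orthonormal_iff_ite.1 ψ.orthonormal, Pi.single_apply]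

theorem sum_smul_eigenSeries_self (a : ι → 𝕜) (S : Finset ι) :
    ∑ k ∈ S, a k • eigenSeries ψ (ψ k) = (S : Set ι).indicator a := by
  classical
  funext j
  simp [eigenSeries_self, Finset.sum_apply, Pi.single_apply, Set.indicator_apply]

theorem sobolevNorm_sub_sum_smul_eigenSeries_self (s : ℝ) (a : ι → 𝕜) (S : Finset ι) :
    sobolevNorm lam s (a - ∑ k ∈ S, a k • eigenSeries ψ (ψ k)) =
      √(∑' k : {k // k ∉ S}, (1 + lam k) ^ s * ‖a k‖ ^ 2) := by
  rw [sum_smul_eigenSeries_self, ← Set.indicator_compl, sobolevNorm,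
    ← tsum_subtype_eq_of_support_subset (s := {k | k ∉ S})]
  · refine congrArg _ (tsum_congr fun k => ?_)
    rw [Set.indicator_of_mem (by simp)]
  · refine Function.support_subset_iff'.2 fun k hk => ?_
    rw [Set.indicator_of_notMem (by simpa using hk), norm_zero]
    ring

theorem MemSobolev.sobolevHasSum {s : ℝ} {a : ι → 𝕜} (ha : MemSobolev lam s a) :
    SobolevHasSum lam s (fun k => a k • eigenSeries ψ (ψ k)) a := by
  classical
  refine ⟨ha, fun k => summable_of_ne_finset_zero (s := {k}) fun j hj => ?_, ?_⟩
  · simp [eigenSeries_self, Finset.notMem_singleton.1 hj]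
  · simp only [sobolevNorm_sub_sum_smul_eigenSeries_self]
    simpa only [Real.sqrt_zero] using (tendsto_tsum_compl_atTop_zero
      fun k => (1 + lam k) ^ s * ‖a k‖ ^ 2).sqrt

theorem eigenSeries_injective : Function.Injective (eigenSeries ψ) := by
  intro v w h
  apply ψ.repr.injective
  ext k
  rw [HilbertBasis.repr_apply_apply, HilbertBasis.repr_apply_apply]
  exact congrFun h k

theorem eigenSeries_add (v w : H) : eigenSeries ψ (v + w) = eigenSeries ψ v + eigenSeries ψ w :=
  funext fun _ => inner_add_right _ _ _

theorem eigenSeries_sub (v w : H) : eigenSeries ψ (v - w) = eigenSeries ψ v - eigenSeries ψ w :=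
  funext fun _ => inner_sub_right _ _ _

theorem eigenSeries_smul (c : 𝕜) (v : H) : eigenSeries ψ (c • v) = c • eigenSeries ψ v :=
  funext fun _ => inner_smul_right _ _ _

theorem hasSum_eigenSeries {β : Type*} {g : β → H} {v : H} (h : HasSum g v) :
    HasSum (fun n => eigenSeries ψ (g n)) (eigenSeries ψ v) :=
  Pi.hasSum.2 fun k => h.mapL (innerSL 𝕜 (ψ k))

theorem hasSum_norm_sq_eigenSeries (v : H) :
    HasSum (fun k => ‖eigenSeries ψ v k‖ ^ 2) (‖v‖ ^ 2) := by
  have h := (ψ.hasSum_inner_mul_inner v v).mapL (RCLike.reCLM (K := 𝕜))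
  simp only [RCLike.reCLM_apply, inner_self_eq_norm_sq] at h
  refine h.congr_fun fun k => ?_
  rw [eigenSeries, ← inner_conj_symm v (ψ k), RCLike.conj_mul]
  norm_cast

theorem norm_le_sobolevNorm (hlam : ∀ k, 0 ≤ lam k) {d : ℝ} (hd : 0 ≤ d) {v : H}
    (hv : MemSobolev lam d (eigenSeries ψ v)) : ‖v‖ ≤ sobolevNorm lam d (eigenSeries ψ v) := by
  have hsum := hasSum_norm_sq_eigenSeries ψ v
  refine Real.le_sqrt_of_sq_le ?_
  rw [← hsum.tsum_eq]
  exact hsum.summable.tsum_le_tsum (fun k => le_mul_of_one_le_left (sq_nonneg _)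
    (Real.one_le_rpow (le_add_of_nonneg_right (hlam k)) hd)) hv

-- The vector `v` lies in the domain of the adjoint of `L`, which is `L`.
theorem mem_domain_of_seriesOp_eq [CompleteSpace H] {L : H →ₗ.[𝕜] H} (hL : IsSelfAdjoint L)
    (hψ : ∀ k, ∃ h : ψ k ∈ L.domain, L ⟨ψ k, h⟩ = (lam k : 𝕜) • ψ k) {v w : H}
    (hw : eigenSeries ψ w = seriesOp lam (eigenSeries ψ v)) : v ∈ L.domain := by
  rw [← LinearPMap.isSelfAdjoint_def.1 hL]
  refine LinearPMap.mem_adjoint_domain_of_exists v ⟨w, fun x => ?_⟩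
  rw [← (ψ.hasSum_inner_mul_inner w x).tsum_eq, ← (ψ.hasSum_inner_mul_inner v (L x)).tsum_eq]
  refine tsum_congr fun k => ?_
  have hLx := congrFun (eigenSeries_apply_eq_seriesOp hL ψ hψ x) k
  have hwk := congrFun hw k
  simp only [eigenSeries, seriesOp] at hLx hwk
  rw [hLx, ← inner_conj_symm w, hwk, ← inner_conj_symm v, map_mul, RCLike.conj_ofReal]
  ring

theorem MemSobolev.mem_domain [CompleteSpace H] {L : H →ₗ.[𝕜] H} (hL : IsSelfAdjoint L)
    (hψ : ∀ k, ∃ h : ψ k ∈ L.domain, L ⟨ψ k, h⟩ = (lam k : 𝕜) • ψ k) (hlam : ∀ k, 0 ≤ lam k)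
    {d : ℝ} (hd : 0 ≤ d) {v : H} (hv : MemSobolev lam (d + 2) (eigenSeries ψ v)) :
    v ∈ L.domain :=
  have ⟨_, hw⟩ := (hv.seriesOp hlam).exists_eigenSeries_eq ψ hlam hd
  mem_domain_of_seriesOp_eq ψ hL hψ hw

variable {q α t : ℝ} {U : ℝ → H} {u : ℝ → ι → 𝕜}

theorem eigenSeries_kernelTerm (h : ∀ n : ℕ, eigenSeries ψ (U (t * q ^ n)) = u (t * q ^ n))
    (n : ℕ) : eigenSeries ψ (kernelTerm 𝕜 q α U t n) = kernelTerm 𝕜 q α u t n := by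
  rw [kernelTerm, kernelTerm, eigenSeries_smul, eigenSeries_sub, h, h]

theorem eigenSeries_caputoTerm (hq0 : 0 < q) (hq1 : q < 1) (hα0 : 0 < α) (hα1 : α < 1)
    (ht : 0 < t) (h : ∀ n : ℕ, eigenSeries ψ (U (t * q ^ n)) = u (t * q ^ n)) (n : ℕ) :
    eigenSeries ψ (caputoTerm 𝕜 q α U t n) = caputoTerm 𝕜 q α u t n := by
  rw [caputoTerm_eq_smul_kernelTerm hq0 hq1 hα0 hα1 ht, eigenSeries_smul,
    eigenSeries_kernelTerm ψ h, ← caputoTerm_eq_smul_kernelTerm hq0 hq1 hα0 hα1 ht]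

theorem eigenSeries_caputo (hq0 : 0 < q) (hq1 : q < 1) (hα0 : 0 < α) (hα1 : α < 1) (ht : 0 < t)
    (h : ∀ n : ℕ, eigenSeries ψ (U (t * q ^ n)) = u (t * q ^ n))
    (hs : Summable (caputoTerm 𝕜 q α U t)) :
    eigenSeries ψ (caputo 𝕜 q α U t) = caputo 𝕜 q α u t := by
  have hsum := hasSum_eigenSeries ψ (hasSum_kernelTerm_of_summable hq0 hq1 hα0 hα1 ht hs)
  simp only [eigenSeries_kernelTerm ψ h, eigenSeries_smul] at hsum
  exact (caputo_eq_of_hasSum hq0 hq1 hα0 hα1 ht hsum).symm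

end Hilbert

/-! ### The inverse problem for a single mode -/

section ModeInverse

variable {𝕜 : Type*} [RCLike 𝕜] {q α m μ T : ℝ}

/-- The coefficient `(x - y) / (1 - e_{α, 1}(-μ T ^ α; q))` of the Mittag-Leffler mode in the
solution of the scalar inverse problem with end values `x` and `y`. -/
noncomputable def modeCoeff (q α μ T : ℝ) (x y : 𝕜) : 𝕜 :=
  (x - y) / ((1 - mlMode q α μ T : ℝ) : 𝕜)

/-- The solution `v` of the scalar inverse problem `ᶜD_q^α v + μ v = h`, `v(0) = x`, `v(T) = y`,
with unknown constant source `h`. -/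
noncomputable def modeSol (q α μ T : ℝ) (x y : 𝕜) (t : ℝ) : 𝕜 :=
  x + modeCoeff q α μ T x y * ((mlMode q α μ t - 1 : ℝ) : 𝕜)

theorem modeSol_zero (hq0 : 0 < q) (hq1 : q < 1) (hα0 : 0 < α) (hμ : 0 ≤ μ) (x y : 𝕜) :
    modeSol q α μ T x y 0 = x := by
  simp [modeSol, mlMode_zero hq0 hq1 hα0 hμ]

theorem modeSol_final (h : 1 - mlMode q α μ T ≠ 0) (x y : 𝕜) : modeSol q α μ T x y T = y := by
  rw [modeSol, modeCoeff, ← neg_sub 1 (mlMode q α μ T), RCLike.ofReal_neg, mul_neg,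
    div_mul_cancel₀ _ (RCLike.ofReal_ne_zero.2 h), neg_sub, add_sub_cancel]

theorem modeSol_sub (x y : 𝕜) (s t : ℝ) : modeSol q α μ T x y s - modeSol q α μ T x y t =
    modeCoeff q α μ T x y * ((mlMode q α μ s - mlMode q α μ t : ℝ) : 𝕜) := by
  rw [modeSol, modeSol, add_sub_add_left_eq_sub, ← mul_sub, ← RCLike.ofReal_sub,
    sub_sub_sub_cancel_right]

theorem hasSum_kernelTerm_modeSol (hq0 : 0 < q) (hq1 : q < 1) (hα0 : 0 < α) (hα1 : α < 1)
    (hμ : 0 ≤ μ) (x y : 𝕜) {t : ℝ} (ht : 0 ≤ t) :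
    HasSum (kernelTerm 𝕜 q α (modeSol q α μ T x y) t)
      ((qStep q α t : 𝕜) * -((μ : 𝕜) * (mlMode q α μ t : 𝕜) * modeCoeff q α μ T x y)) := by
  have h := ((hasSum_latticeKernel_mul_mlMode_sub hq0 hq1 hα0 hα1 hμ ht).mapL
    (RCLike.ofRealCLM (K := 𝕜))).mul_left (modeCoeff q α μ T x y)
  convert! h using 1
  · funext n
    rw [kernelTerm, modeSol_sub, smul_eq_mul, RCLike.ofRealCLM_apply, RCLike.ofReal_mul]
    ring
  · rw [RCLike.ofRealCLM_apply]
    push_cast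
    ring

section Bounds

variable (hq0 : 0 < q) (hq1 : q < 1) (hα0 : 0 < α) (hα1 : α < 1) (hm : 0 < m) (hμ : m ≤ μ)
  (hT : 0 < T) (x y : 𝕜)

include hq0 hq1 hα0 hα1 hm hμ hT

theorem norm_modeCoeff_le :
    ‖modeCoeff q α μ T x y‖ ≤ (modeGap q α m T)⁻¹ * (‖x‖ + ‖y‖) := by
  have hgap := modeGap_pos (α := α) hq1 hm hT
  have hle := modeGap_le hq0 hq1 hα0 hα1 hm hμ hT
  rw [modeCoeff, norm_div, RCLike.norm_ofReal, abs_of_pos (hgap.trans_le hle), div_eq_inv_mul]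
  have := norm_sub_le x y
  gcongr

theorem norm_modeSol_le {t : ℝ} (ht : 0 ≤ t) :
    ‖modeSol q α μ T x y t‖ ≤ (1 + 2 * (modeGap q α m T)⁻¹) * (‖x‖ + ‖y‖) := by
  have hcoeff := norm_modeCoeff_le hq0 hq1 hα0 hα1 hm hμ hT x y
  have hmode : |mlMode q α μ t - 1| ≤ 2 := by
    have := abs_le.1 (abs_mlMode_le_one hq0 hq1 hα0 hα1 (hm.le.trans hμ) ht)
    exact abs_le.2 ⟨by linarith, by linarith⟩
  calc ‖modeSol q α μ T x y t‖ ≤ ‖x‖ + ‖modeCoeff q α μ T x y‖ * |mlMode q α μ t - 1| := by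
        rw [modeSol, ← RCLike.norm_ofReal (K := 𝕜), ← norm_mul]
        exact norm_add_le _ _
    _ ≤ (‖x‖ + ‖y‖) + (modeGap q α m T)⁻¹ * (‖x‖ + ‖y‖) * 2 :=
        add_le_add (le_add_of_nonneg_right (norm_nonneg y))
          (mul_le_mul hcoeff hmode (abs_nonneg _) ((norm_nonneg _).trans hcoeff))
    _ = (1 + 2 * (modeGap q α m T)⁻¹) * (‖x‖ + ‖y‖) := by ring

theorem norm_modeSol_sub_le {s t : ℝ} (hs : 0 ≤ s) (ht : 0 ≤ t) :
    ‖modeSol q α μ T x y s - modeSol q α μ T x y t‖ ≤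
      (modeGap q α m T)⁻¹ * mlLip q * |qStep q α s - qStep q α t| * (μ * (‖x‖ + ‖y‖)) := by
  have hcoeff := norm_modeCoeff_le hq0 hq1 hα0 hα1 hm hμ hT x y
  rw [modeSol_sub, norm_mul, RCLike.norm_ofReal]
  refine (mul_le_mul hcoeff (abs_mlMode_sub_le hq0 hq1 hα0 (hm.le.trans hμ) hs ht) (abs_nonneg _)
    ((norm_nonneg _).trans hcoeff)).trans (le_of_eq ?_)
  ring

theorem norm_mul_mlMode_mul_modeCoeff_le {t : ℝ} (ht : 0 ≤ t) :
    ‖(μ : 𝕜) * (mlMode q α μ t : 𝕜) * modeCoeff q α μ T x y‖ ≤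
      (modeGap q α m T)⁻¹ * (μ * (‖x‖ + ‖y‖)) := by
  have hμ0 := hm.le.trans hμ
  have hmode := abs_mlMode_le_one hq0 hq1 hα0 hα1 hμ0 ht
  rw [norm_mul, norm_mul, RCLike.norm_ofReal, RCLike.norm_ofReal, abs_of_nonneg hμ0,
    mul_left_comm]
  exact mul_le_mul (mul_le_of_le_one_right hμ0 hmode)
    (norm_modeCoeff_le hq0 hq1 hα0 hα1 hm hμ hT x y) (norm_nonneg _) hμ0

theorem norm_mul_sub_modeCoeff_le :
    ‖(μ : 𝕜) * (x - modeCoeff q α μ T x y)‖ ≤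
      (1 + (modeGap q α m T)⁻¹) * (μ * (‖x‖ + ‖y‖)) := by
  have hμ0 := hm.le.trans hμ
  rw [norm_mul, RCLike.norm_ofReal, abs_of_nonneg hμ0, mul_left_comm, one_add_mul]
  exact mul_le_mul_of_nonneg_left ((norm_sub_le _ _).trans (add_le_add
    (le_add_of_nonneg_right (norm_nonneg y)) (norm_modeCoeff_le hq0 hq1 hα0 hα1 hm hμ hT x y))) hμ0

end Bounds

end ModeInverse

/-! ### The inverse problem in the Sobolev scale -/

section Solution

variable {ι 𝕜 : Type*} [RCLike 𝕜] {lam : ι → ℝ} {q α m T d : ℝ} {φ ρ : ι → 𝕜}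

/-- The component `u` of the solution of the inverse source problem. -/
noncomputable def inverseSol (lam : ι → ℝ) (q α m T : ℝ) (φ ρ : ι → 𝕜) (t : ℝ) : ι → 𝕜 :=
  fun k => modeSol q α (lam k + m) T (φ k) (ρ k) t

/-- The component `f` of the solution of the inverse source problem. -/
noncomputable def inverseSource (lam : ι → ℝ) (q α m T : ℝ) (φ ρ : ι → 𝕜) : ι → 𝕜 :=
  fun k => ((lam k + m : ℝ) : 𝕜) * (φ k - modeCoeff q α (lam k + m) T (φ k) (ρ k))

/-- The closed form of the Caputo derivative of `inverseSol`. -/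
noncomputable def inverseCaputo (lam : ι → ℝ) (q α m T : ℝ) (φ ρ : ι → 𝕜) (t : ℝ) : ι → 𝕜 :=
  fun k => -(((lam k + m : ℝ) : 𝕜) * (mlMode q α (lam k + m) t : 𝕜) *
    modeCoeff q α (lam k + m) T (φ k) (ρ k))

theorem inverseCaputo_add_inverseSol (t : ℝ) :
    inverseCaputo lam q α m T φ ρ t + seriesOp lam (inverseSol lam q α m T φ ρ t) +
      (m : 𝕜) • inverseSol lam q α m T φ ρ t = inverseSource lam q α m T φ ρ := by
  funext k
  simp only [Pi.add_apply, Pi.smul_apply, smul_eq_mul, inverseCaputo, inverseSol, inverseSource,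
    seriesOp, modeSol]
  push_cast
  ring

theorem inverseSol_zero (hlam : ∀ k, 0 ≤ lam k) (hq0 : 0 < q) (hq1 : q < 1) (hα0 : 0 < α)
    (hm : 0 ≤ m) : inverseSol lam q α m T φ ρ 0 = φ :=
  funext fun k => modeSol_zero hq0 hq1 hα0 (add_nonneg (hlam k) hm) _ _

theorem inverseSol_final (hlam : ∀ k, 0 ≤ lam k) (hq0 : 0 < q) (hq1 : q < 1) (hα0 : 0 < α)
    (hα1 : α < 1) (hm : 0 < m) (hT : 0 < T) : inverseSol lam q α m T φ ρ T = ρ :=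
  funext fun k => modeSol_final
    (one_sub_mlMode_pos hq0 hq1 hα0 hα1 (add_pos_of_nonneg_of_pos (hlam k) hm) hT).ne' _ _

theorem caputo_inverseSol (hlam : ∀ k, 0 ≤ lam k) (hq0 : 0 < q) (hq1 : q < 1)
    (hα0 : 0 < α) (hα1 : α < 1) (hm : 0 ≤ m) {t : ℝ} (ht : 0 < t) :
    caputo 𝕜 q α (inverseSol lam q α m T φ ρ) t = inverseCaputo lam q α m T φ ρ t :=
  caputo_eq_of_hasSum hq0 hq1 hα0 hα1 ht <| Pi.hasSum.2 fun k =>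
    hasSum_kernelTerm_modeSol hq0 hq1 hα0 hα1 (add_nonneg (hlam k) hm) (φ k) (ρ k) ht.le

theorem MemSobolev.of_norm_le_add_mul (hlam : ∀ k, 0 ≤ lam k) (hm : 0 ≤ m) {b : ι → ℝ}
    (hb : MemSobolev lam (d + 2) b) {a : ι → 𝕜} {c : ℝ} (hc : 0 ≤ c)
    (h : ∀ k, ‖a k‖ ≤ c * ((lam k + m) * ‖b k‖)) :
    MemSobolev lam d a ∧ sobolevNorm lam d a ≤ c * (1 + m) * sobolevNorm lam (d + 2) b := by
  refine hb.of_norm_le_mul hlam (by positivity) fun k => (h k).trans ?_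
  have hle : lam k + m ≤ (1 + m) * (1 + lam k) := by linarith [mul_nonneg hm (hlam k)]
  rw [mul_assoc c, ← mul_assoc (1 + m)]
  gcongr

section Bounds

variable (hlam : ∀ k, 0 ≤ lam k) (hq0 : 0 < q) (hq1 : q < 1) (hα0 : 0 < α) (hα1 : α < 1)
  (hm : 0 < m) (hT : 0 < T) (hφ : MemSobolev lam (d + 2) φ) (hρ : MemSobolev lam (d + 2) ρ)

include hlam hq0 hq1 hα0 hα1 hm hT hφ hρ

theorem inverseSol_bound {t : ℝ} (ht : 0 ≤ t) :
    MemSobolev lam (d + 2) (inverseSol lam q α m T φ ρ t) ∧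
      sobolevNorm lam (d + 2) (inverseSol lam q α m T φ ρ t) ≤
        (1 + 2 * (modeGap q α m T)⁻¹) * sobolevNorm lam (d + 2) (majorant φ ρ) := by
  have := modeGap_pos (α := α) hq1 hm hT
  refine (hφ.majorant hlam hρ).of_norm_le hlam (by positivity) fun k => ?_
  rw [norm_majorant]
  exact norm_modeSol_le hq0 hq1 hα0 hα1 hm (le_add_of_nonneg_left (hlam k)) hT _ _ ht

theorem inverseSol_sub_bound {s t : ℝ} (hs : 0 ≤ s) (ht : 0 ≤ t) :
    MemSobolev lam d (inverseSol lam q α m T φ ρ s - inverseSol lam q α m T φ ρ t) ∧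
      sobolevNorm lam d (inverseSol lam q α m T φ ρ s - inverseSol lam q α m T φ ρ t) ≤
        (modeGap q α m T)⁻¹ * mlLip q * |qStep q α s - qStep q α t| * (1 + m) *
          sobolevNorm lam (d + 2) (majorant φ ρ) := by
  have := modeGap_pos (α := α) hq1 hm hT
  have := mlLip_nonneg (q := q)
  refine (hφ.majorant hlam hρ).of_norm_le_add_mul hlam hm.le (by positivity) fun k => ?_
  rw [norm_majorant]
  exact norm_modeSol_sub_le hq0 hq1 hα0 hα1 hm (le_add_of_nonneg_left (hlam k)) hT _ _ hs ht

theorem inverseCaputo_bound {t : ℝ} (ht : 0 ≤ t) :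
    MemSobolev lam d (inverseCaputo lam q α m T φ ρ t) ∧
      sobolevNorm lam d (inverseCaputo lam q α m T φ ρ t) ≤
        (modeGap q α m T)⁻¹ * (1 + m) * sobolevNorm lam (d + 2) (majorant φ ρ) := by
  have := modeGap_pos (α := α) hq1 hm hT
  refine (hφ.majorant hlam hρ).of_norm_le_add_mul hlam hm.le (by positivity) fun k => ?_
  rw [norm_majorant, inverseCaputo, norm_neg]
  exact norm_mul_mlMode_mul_modeCoeff_le hq0 hq1 hα0 hα1 hm (le_add_of_nonneg_left (hlam k)) hT
    _ _ ht

theorem inverseSource_bound :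
    MemSobolev lam d (inverseSource lam q α m T φ ρ) ∧
      sobolevNorm lam d (inverseSource lam q α m T φ ρ) ≤
        (1 + (modeGap q α m T)⁻¹) * (1 + m) * sobolevNorm lam (d + 2) (majorant φ ρ) := by
  have := modeGap_pos (α := α) hq1 hm hT
  refine (hφ.majorant hlam hρ).of_norm_le_add_mul hlam hm.le (by positivity) fun k => ?_
  rw [norm_majorant]
  exact norm_mul_sub_modeCoeff_le hq0 hq1 hα0 hα1 hm (le_add_of_nonneg_left (hlam k)) hT _ _

theorem tendsto_sobolevNorm_inverseSol_sub {t : ℝ} (ht : 0 ≤ t) :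
    Tendsto (fun n : ℕ => sobolevNorm lam d
      (inverseSol lam q α m T φ ρ (t * q ^ n) - inverseSol lam q α m T φ ρ 0)) atTop (𝓝 0) := by
  refine tendsto_sobolevNorm_sub_of_le_qStep hq0 hq1 hα0 ht (A := (modeGap q α m T)⁻¹ * mlLip q *
    (1 + m) * sobolevNorm lam (d + 2) (majorant φ ρ)) fun n => ?_
  have htn := mul_nonneg ht (pow_pos hq0 n).le
  refine (inverseSol_sub_bound hlam hq0 hq1 hα0 hα1 hm hT hφ hρ htn le_rfl).2.trans (le_of_eq ?_)
  rw [qStep_zero hα0, sub_zero, abs_of_nonneg (qStep_nonneg hq1 htn)]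
  ring

theorem summable_sobolevNorm_caputoTerm_inverseSol {t : ℝ} (ht : 0 < t) :
    Summable fun n : ℕ =>
      sobolevNorm lam d (caputoTerm 𝕜 q α (inverseSol lam q α m T φ ρ) t n) := by
  refine summable_sobolevNorm_caputoTerm_of_le_qStep hlam hq0 hq1 hα0 hα1 ht
    (A := (modeGap q α m T)⁻¹ * mlLip q * (1 + m) * sobolevNorm lam (d + 2) (majorant φ ρ))
    fun n => ?_
  have htn (n : ℕ) := mul_nonneg ht.le (pow_pos hq0 n).le
  have hsub := inverseSol_sub_bound hlam hq0 hq1 hα0 hα1 hm hT hφ hρ (htn n) (htn (n + 1))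
  refine ⟨hsub.1, hsub.2.trans ?_⟩
  have hstep : |qStep q α (t * q ^ n) - qStep q α (t * q ^ (n + 1))| ≤ qStep q α (t * q ^ n) := by
    refine abs_sub_le_of_nonneg_of_le (qStep_nonneg hq1 (htn n)) le_rfl
      (qStep_nonneg hq1 (htn (n + 1))) ?_
    rw [qStep_mul_pow hq0 hq1 ht.le, qStep_mul_pow hq0 hq1 ht.le]
    exact mul_le_mul_of_nonneg_left (pow_le_pow_of_le_one (Real.rpow_nonneg hq0.le α)
      (Real.rpow_le_one hq0.le hq1.le hα0.le) n.le_succ) (qStep_nonneg hq1 ht.le)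
  calc _ = (modeGap q α m T)⁻¹ * mlLip q * (1 + m) * sobolevNorm lam (d + 2) (majorant φ ρ) *
        |qStep q α (t * q ^ n) - qStep q α (t * q ^ (n + 1))| := by ring
    _ ≤ _ := by
      have := modeGap_pos (α := α) hq1 hm hT
      have := mlLip_nonneg (q := q)
      have := sobolevNorm_nonneg lam (d + 2) (majorant φ ρ)
      gcongr

theorem memLinfty_inverseSol : MemLinfty lam T (d + 2) (inverseSol lam q α m T φ ρ) :=
  have hbound {t : ℝ} (ht : t ∈ Icc 0 T) :=
    inverseSol_bound hlam hq0 hq1 hα0 hα1 hm hT hφ hρ ht.1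
  ⟨fun _ ht => (hbound ht).1, _, forall_mem_image.2 fun _ ht => (hbound ht).2⟩

end Bounds

theorem MemLinfty.of_add_two (hlam : ∀ k, 0 ≤ lam k) {u : ℝ → ι → 𝕜}
    (hu : MemLinfty lam T (d + 2) u) : MemLinfty lam T d u :=
  have ⟨M, hM⟩ := hu.2
  ⟨fun t ht => ((hu.1 t ht).of_add_two hlam).1, M, forall_mem_image.2 fun t ht =>
    ((hu.1 t ht).of_add_two hlam).2.trans (forall_mem_image.1 hM ht)⟩

section Existence

variable (hlam : ∀ k, 0 ≤ lam k) (hq0 : 0 < q) (hq1 : q < 1) (hα0 : 0 < α) (hα1 : α < 1)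
  (hm : 0 < m) (hT : 0 < T) (hφ : MemSobolev lam (d + 2) φ) (hρ : MemSobolev lam (d + 2) ρ)

include hlam hq0 hq1 hα0 hα1 hm hT hφ hρ

theorem memW_inverseSol : MemW lam q α T d (inverseSol lam q α m T φ ρ) := by
  have hcaputo {t : ℝ} (ht : t ∈ Ioc 0 T) :
      caputo 𝕜 q α (inverseSol lam q α m T φ ρ) t = inverseCaputo lam q α m T φ ρ t :=
    caputo_inverseSol hlam hq0 hq1 hα0 hα1 hm.le ht.1
  have hbound {t : ℝ} (ht : t ∈ Ioc 0 T) :=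
    inverseCaputo_bound hlam hq0 hq1 hα0 hα1 hm hT hφ hρ ht.1.le
  exact
  { memLinfty := (memLinfty_inverseSol hlam hq0 hq1 hα0 hα1 hm hT hφ hρ).of_add_two hlam
    regular := fun t ht =>
      tendsto_sobolevNorm_inverseSol_sub hlam hq0 hq1 hα0 hα1 hm hT hφ hρ ht.1.le
    summable := fun t ht =>
      summable_sobolevNorm_caputoTerm_inverseSol hlam hq0 hq1 hα0 hα1 hm hT hφ hρ ht.1
    caputo_mem := fun t ht => by
      rw [hcaputo ht]
      exact (hbound ht).1
    caputo_bdd := ⟨_, forall_mem_image.2 fun t ht => by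
      rw [hcaputo ht]
      exact (hbound ht).2⟩ }

theorem isInverseSolution_inverseSol :
    IsInverseSolution lam q α m T d φ ρ (inverseSol lam q α m T φ ρ)
      (inverseSource lam q α m T φ ρ) where
  memLinfty := memLinfty_inverseSol hlam hq0 hq1 hα0 hα1 hm hT hφ hρ
  memW := memW_inverseSol hlam hq0 hq1 hα0 hα1 hm hT hφ hρ
  equation t ht := by
    rw [caputo_inverseSol hlam hq0 hq1 hα0 hα1 hm.le ht.1, inverseCaputo_add_inverseSol]
  initial := inverseSol_zero hlam hq0 hq1 hα0 hm.le
  final := inverseSol_final hlam hq0 hq1 hα0 hα1 hm hT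

end Existence

namespace IsInverseSolution

variable {v w : ℝ → ι → 𝕜} {g h : ι → 𝕜}

theorem hasSum_kernelTerm_apply (hlam : ∀ k, 0 ≤ lam k) (hq0 : 0 < q) (hq1 : q < 1)
    (hα0 : 0 < α) (hα1 : α < 1) (hv : IsInverseSolution lam q α m T d φ ρ v g) {t : ℝ}
    (ht : t ∈ Ioc 0 T) (k : ι) :
    HasSum (kernelTerm 𝕜 q α (fun s => v s k) t)
      ((qStep q α t : 𝕜) * (g k - ((lam k + m : ℝ) : 𝕜) * v t k)) := by
  have hsummable : Summable (caputoTerm 𝕜 q α v t) := summable_of_summable_sobolevNorm hlam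
    (hv.memW.memLinfty.memSobolev_caputoTerm hlam hq0 hq1 hα0 hα1 ht) (hv.memW.summable t ht)
  have hcaputo : g k - ((lam k + m : ℝ) : 𝕜) * v t k = caputo 𝕜 q α v t k := by
    rw [← hv.equation t ht]
    simp only [Pi.add_apply, Pi.smul_apply, smul_eq_mul, seriesOp, RCLike.ofReal_add]
    ring
  have hseries := hasSum_kernelTerm_of_summable hq0 hq1 hα0 hα1 ht.1 hsummable
  rw [hcaputo]
  exact Pi.hasSum.1 hseries k

theorem tendsto_apply (hlam : ∀ k, 0 ≤ lam k) (hq0 : 0 < q) (hq1 : q < 1)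
    (hv : IsInverseSolution lam q α m T d φ ρ v g) {t : ℝ} (ht : t ∈ Ioc 0 T) (k : ι) :
    Tendsto (fun n : ℕ => v (t * q ^ n) k) atTop (𝓝 (φ k)) := by
  rw [← hv.initial]
  exact tendsto_apply_of_tendsto_sobolevNorm hlam (fun n =>
    (hv.memW.memLinfty.1 _ (Ioc_subset_Icc_self (mul_pow_mem_Ioc hq0 hq1 ht n))).sub hlam
      (hv.memW.memLinfty.1 0 ⟨le_rfl, ht.1.le.trans ht.2⟩)) (hv.memW.regular t ht) k

theorem unique (hlam : ∀ k, 0 ≤ lam k) (hq0 : 0 < q) (hq1 : q < 1) (hα0 : 0 < α) (hα1 : α < 1)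
    (hm : 0 < m) (hT : 0 < T) (hv : IsInverseSolution lam q α m T d φ ρ v g)
    (hw : IsInverseSolution lam q α m T d φ ρ w h) : (∀ t ∈ Icc 0 T, v t = w t) ∧ g = h := by
  have hzero (k : ι) : g k - h k = 0 ∧ ∀ t ∈ Ioc 0 T, v t k - w t k = 0 := by
    refine eq_zero_of_hasSum_kernelTerm (v := fun t => v t k - w t k) hq0 hq1 hα0 hα1
      (add_pos_of_nonneg_of_pos (hlam k) hm) hT (fun t ht => ?_) (fun t ht => ?_) ?_
    · simpa only [sub_self] using
        (hv.tendsto_apply hlam hq0 hq1 ht k).sub (hw.tendsto_apply hlam hq0 hq1 ht k)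
    · convert! (hv.hasSum_kernelTerm_apply hlam hq0 hq1 hα0 hα1 ht k).sub
        (hw.hasSum_kernelTerm_apply hlam hq0 hq1 hα0 hα1 ht k) using 1
      · funext n
        simp only [kernelTerm, smul_eq_mul]
        ring
      · ring
    · rw [hv.final, hw.final, sub_self]
  refine ⟨fun t ht => ?_, funext fun k => sub_eq_zero.1 (hzero k).1⟩
  rcases eq_or_lt_of_le ht.1 with rfl | ht0
  · rw [hv.initial, hw.initial]
  · exact funext fun k => sub_eq_zero.1 ((hzero k).2 t ⟨ht0, ht.2⟩)

end IsInverseSolution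

end Solution

section HilbertSolution

variable {ι 𝕜 H : Type*} [RCLike 𝕜] [NormedAddCommGroup H] [InnerProductSpace 𝕜 H]
  {lam : ι → ℝ} {q α m T d : ℝ} {φ ρ : ι → 𝕜} {u : ℝ → ι → 𝕜}
  (ψ : HilbertBasis ι 𝕜 H)

theorem MemLinfty.exists_eigenSeries_eq (hlam : ∀ k, 0 ≤ lam k) (hd : 0 ≤ d)
    (hu : MemLinfty lam T d u) : ∃ U : ℝ → H, ∀ t ∈ Icc 0 T, eigenSeries ψ (U t) = u t := by
  choose! U hU using fun t ht => (hu.1 t ht).exists_eigenSeries_eq ψ hlam hd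
  exact ⟨U, hU⟩

theorem MemW.summable_norm_caputoTerm (hlam : ∀ k, 0 ≤ lam k) (hq0 : 0 < q) (hq1 : q < 1)
    (hα0 : 0 < α) (hα1 : α < 1) (hd : 0 ≤ d) (hu : MemW lam q α T d u) {t : ℝ} (ht : t ∈ Ioc 0 T)
    {U : ℝ → H} (hU : ∀ n : ℕ, eigenSeries ψ (U (t * q ^ n)) = u (t * q ^ n)) :
    Summable fun n : ℕ => ‖caputoTerm 𝕜 q α U t n‖ := by
  refine Summable.of_nonneg_of_le (fun _ => norm_nonneg _) (fun n => ?_) (hu.summable t ht)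
  have hmem := hu.memLinfty.memSobolev_caputoTerm hlam hq0 hq1 hα0 hα1 ht n
  rw [← eigenSeries_caputoTerm ψ hq0 hq1 hα0 hα1 ht.1 hU] at hmem ⊢
  exact norm_le_sobolevNorm ψ hlam hd hmem

theorem IsInverseSolution.exists_hilbert_solution [CompleteSpace H] {L : H →ₗ.[𝕜] H}
    (hL : IsSelfAdjoint L) (hlam : ∀ k, 0 ≤ lam k)
    (hψ : ∀ k, ∃ h : ψ k ∈ L.domain, L ⟨ψ k, h⟩ = (lam k : 𝕜) • ψ k)
    (hq0 : 0 < q) (hq1 : q < 1) (hα0 : 0 < α) (hα1 : α < 1) (hd : 0 ≤ d) {f : ι → 𝕜}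
    (h : IsInverseSolution lam q α m T d φ ρ u f) (hf : MemSobolev lam d f) :
    ∃ (U : ℝ → H) (F : H),
      (∀ t ∈ Icc 0 T, eigenSeries ψ (U t) = u t) ∧ eigenSeries ψ F = f ∧
      ∀ t ∈ Ioc 0 T, (Summable fun n : ℕ => ‖caputoTerm 𝕜 q α U t n‖) ∧
        ∃ h : U t ∈ L.domain, caputo 𝕜 q α U t + L ⟨U t, h⟩ + (m : 𝕜) • U t = F := by
  obtain ⟨U, hU⟩ := h.memW.memLinfty.exists_eigenSeries_eq ψ hlam hd
  obtain ⟨F, hF⟩ := hf.exists_eigenSeries_eq ψ hlam hd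
  refine ⟨U, F, hU, hF, fun t ht => ?_⟩
  have hUt := hU t (Ioc_subset_Icc_self ht)
  have hUn (n : ℕ) := hU _ (Ioc_subset_Icc_self (mul_pow_mem_Ioc hq0 hq1 ht n))
  have hsum := h.memW.summable_norm_caputoTerm ψ hlam hq0 hq1 hα0 hα1 hd ht hUn
  have hdom : U t ∈ L.domain := MemSobolev.mem_domain ψ hL hψ hlam hd <| by
    rw [hUt]
    exact h.memLinfty.1 t (Ioc_subset_Icc_self ht)
  refine ⟨hsum, hdom, eigenSeries_injective ψ ?_⟩
  rw [eigenSeries_add, eigenSeries_add, eigenSeries_smul, eigenSeries_apply_eq_seriesOp hL ψ hψ,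
    eigenSeries_caputo ψ hq0 hq1 hα0 hα1 ht.1 hUn hsum.of_norm, hUt, hF, h.equation t ht]

end HilbertSolution

section Conclusion

variable {ι 𝕜 : Type*} [RCLike 𝕜] {lam : ι → ℝ} {q α m T d : ℝ} {φ ρ : ι → 𝕜}

/-- The constant of the stability estimate: twice the sum of the squares of the operator norms
found for `inverseCaputo`, `inverseSol` and `inverseSource`. -/
noncomputable def inverseConst (q α m T : ℝ) : ℝ :=
  2 * (((modeGap q α m T)⁻¹ * (1 + m)) ^ 2 + (1 + 2 * (modeGap q α m T)⁻¹) ^ 2 +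
    ((1 + (modeGap q α m T)⁻¹) * (1 + m)) ^ 2)

theorem inverseConst_pos (hq1 : q < 1) (hm : 0 < m) (hT : 0 < T) : 0 < inverseConst q α m T := by
  have := modeGap_pos (α := α) hq1 hm hT
  unfold inverseConst
  positivity

theorem sq_sobolevNorm_le_of_le_majorant (hlam : ∀ k, 0 ≤ lam k) {s s' : ℝ} {a : ι → 𝕜}
    (hφ : MemSobolev lam s' φ) (hρ : MemSobolev lam s' ρ) {c : ℝ}
    (h : sobolevNorm lam s a ≤ c * sobolevNorm lam s' (majorant φ ρ)) :
    sobolevNorm lam s a ^ 2 ≤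
      2 * c ^ 2 * (sobolevNorm lam s' φ ^ 2 + sobolevNorm lam s' ρ ^ 2) := by
  calc sobolevNorm lam s a ^ 2 ≤ c ^ 2 * sobolevNorm lam s' (majorant φ ρ) ^ 2 := by
        rw [← mul_pow]
        exact pow_le_pow_left₀ (sobolevNorm_nonneg _ _ _) h 2
    _ ≤ c ^ 2 * (2 * (sobolevNorm lam s' φ ^ 2 + sobolevNorm lam s' ρ ^ 2)) :=
        mul_le_mul_of_nonneg_left (sobolevNorm_majorant_sq_le hlam hφ hρ) (sq_nonneg c)
    _ = _ := by ring

variable (hlam : ∀ k, 0 ≤ lam k) (hq0 : 0 < q) (hq1 : q < 1) (hα0 : 0 < α) (hα1 : α < 1)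
  (hm : 0 < m) (hT : 0 < T) (hφ : MemSobolev lam (d + 2) φ) (hρ : MemSobolev lam (d + 2) ρ)

include hlam hq0 hq1 hα0 hα1 hm hT hφ hρ

theorem sq_sobolevNorm_caputo_inverseSol_add_le {t : ℝ} (ht : 0 < t) :
    sobolevNorm lam d (caputo 𝕜 q α (inverseSol lam q α m T φ ρ) t) ^ 2 +
        sobolevNorm lam (d + 2) (inverseSol lam q α m T φ ρ t) ^ 2 ≤
      inverseConst q α m T *
        (sobolevNorm lam (d + 2) φ ^ 2 + sobolevNorm lam (d + 2) ρ ^ 2) := by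
  have hcaputo := sq_sobolevNorm_le_of_le_majorant hlam hφ hρ
    (inverseCaputo_bound hlam hq0 hq1 hα0 hα1 hm hT hφ hρ ht.le).2
  have hsol := sq_sobolevNorm_le_of_le_majorant hlam hφ hρ
    (inverseSol_bound hlam hq0 hq1 hα0 hα1 hm hT hφ hρ ht.le).2
  rw [caputo_inverseSol hlam hq0 hq1 hα0 hα1 hm.le ht]
  refine (add_le_add hcaputo hsol).trans ?_
  rw [← add_mul, ← mul_add, inverseConst]
  refine mul_le_mul_of_nonneg_right (mul_le_mul_of_nonneg_left ?_ zero_le_two) (by positivity)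
  exact le_add_of_nonneg_right (sq_nonneg _)

theorem sq_sobolevNorm_inverseSource_le :
    sobolevNorm lam d (inverseSource lam q α m T φ ρ) ^ 2 ≤ inverseConst q α m T *
      (sobolevNorm lam (d + 2) φ ^ 2 + sobolevNorm lam (d + 2) ρ ^ 2) := by
  refine (sq_sobolevNorm_le_of_le_majorant hlam hφ hρ
    (inverseSource_bound hlam hq0 hq1 hα0 hα1 hm hT hφ hρ).2).trans ?_
  rw [inverseConst]
  gcongr
  exact le_add_of_nonneg_left (by positivity)

variable {H : Type*} [NormedAddCommGroup H] [InnerProductSpace 𝕜 H] (ψ : HilbertBasis ι 𝕜 H)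

theorem sobolevHasSum_inverseSol_sub {t : ℝ} (ht : 0 ≤ t) :
    SobolevHasSum lam (d + 2)
      (fun k => ((φ k - ρ k) * ((qMittagLeffler q α 1 (-(lam k + m) * t ^ α) - 1 : ℝ) : 𝕜) /
        ((1 - qMittagLeffler q α 1 (-(lam k + m) * T ^ α) : ℝ) : 𝕜)) • eigenSeries ψ (ψ k))
      (inverseSol lam q α m T φ ρ t - φ) := by
  have hmem := (inverseSol_bound hlam hq0 hq1 hα0 hα1 hm hT hφ hρ ht).1.sub hlam hφ
  convert! hmem.sobolevHasSum ψ using 3 with k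
  rw [Pi.sub_apply, inverseSol, modeSol, modeCoeff, mlMode, mlMode, add_sub_cancel_left,
    mul_div_right_comm]

theorem sobolevHasSum_sub_inverseSource :
    SobolevHasSum lam d
      (fun k => (((lam k + m : ℝ) : 𝕜) * (φ k - ρ k) /
        ((1 - qMittagLeffler q α 1 (-(lam k + m) * T ^ α) : ℝ) : 𝕜)) • eigenSeries ψ (ψ k))
      (seriesOp lam φ + (m : 𝕜) • φ - inverseSource lam q α m T φ ρ) := by
  have hmem := (((hφ.seriesOp hlam).add hlam ((hφ.of_add_two hlam).1.smul hlam (m : 𝕜))).sub hlam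
    (inverseSource_bound hlam hq0 hq1 hα0 hα1 hm hT hφ hρ).1)
  convert! hmem.sobolevHasSum ψ using 3 with k
  simp only [Pi.sub_apply, Pi.add_apply, Pi.smul_apply, smul_eq_mul, seriesOp, inverseSource,
    modeCoeff, mlMode]
  push_cast
  ring

end Conclusion

theorem theorem5p1_general {𝕜 ι H : Type*} [RCLike 𝕜] [NormedAddCommGroup H]
    [InnerProductSpace 𝕜 H] [CompleteSpace H]
    (L : H →ₗ.[𝕜] H) (hL : IsSelfAdjoint L)
    (ψ : HilbertBasis ι 𝕜 H) (lam : ι → ℝ) (hlam : ∀ k, 0 ≤ lam k)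
    (hψ : ∀ k, ∃ h : ψ k ∈ L.domain, L ⟨ψ k, h⟩ = (lam k : 𝕜) • ψ k)
    (q α m T : ℝ) (hq0 : 0 < q) (hq1 : q < 1) (hα0 : 0 < α) (hα1 : α < 1)
    (hm : 0 < m) (hT : 0 < T) (d : ℝ) (φ ρ : ι → 𝕜)
    (hφ : MemSobolev lam (d + 2) φ) (hρ : MemSobolev lam (d + 2) ρ) :
    IsInverseSolution lam q α m T d φ ρ (inverseSol lam q α m T φ ρ)
      (inverseSource lam q α m T φ ρ) ∧
    MemSobolev lam d (inverseSource lam q α m T φ ρ) ∧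
    (0 ≤ d → ∃ (U : ℝ → H) (F : H),
      (∀ t ∈ Icc 0 T, eigenSeries ψ (U t) = inverseSol lam q α m T φ ρ t) ∧
      eigenSeries ψ F = inverseSource lam q α m T φ ρ ∧
      ∀ t ∈ Ioc 0 T, (Summable fun n : ℕ => ‖caputoTerm 𝕜 q α U t n‖) ∧
        ∃ h : U t ∈ L.domain, caputo 𝕜 q α U t + L ⟨U t, h⟩ + (m : 𝕜) • U t = F) ∧
    (∀ (v : ℝ → ι → 𝕜) (g : ι → 𝕜), IsInverseSolution lam q α m T d φ ρ v g →
      (∀ t ∈ Icc 0 T, v t = inverseSol lam q α m T φ ρ t) ∧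
        g = inverseSource lam q α m T φ ρ) ∧
    (∀ t ∈ Icc 0 T, SobolevHasSum lam (d + 2)
      (fun k => ((φ k - ρ k) * ((qMittagLeffler q α 1 (-(lam k + m) * t ^ α) - 1 : ℝ) : 𝕜) /
        ((1 - qMittagLeffler q α 1 (-(lam k + m) * T ^ α) : ℝ) : 𝕜)) • eigenSeries ψ (ψ k))
      (inverseSol lam q α m T φ ρ t - φ)) ∧
    SobolevHasSum lam d
      (fun k => (((lam k + m : ℝ) : 𝕜) * (φ k - ρ k) /
        ((1 - qMittagLeffler q α 1 (-(lam k + m) * T ^ α) : ℝ) : 𝕜)) • eigenSeries ψ (ψ k))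
      (seriesOp lam φ + (m : 𝕜) • φ - inverseSource lam q α m T φ ρ) ∧
    (∀ k, qMittagLeffler q α 1 (-(lam k + m) * T ^ α) < 1) ∧
    (∀ t ∈ Ioc 0 T,
      sobolevNorm lam d (caputo 𝕜 q α (inverseSol lam q α m T φ ρ) t) ^ 2 +
          sobolevNorm lam (d + 2) (inverseSol lam q α m T φ ρ t) ^ 2 ≤
        inverseConst q α m T *
          (sobolevNorm lam (d + 2) φ ^ 2 + sobolevNorm lam (d + 2) ρ ^ 2)) ∧
    sobolevNorm lam d (inverseSource lam q α m T φ ρ) ^ 2 ≤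
      inverseConst q α m T *
        (sobolevNorm lam (d + 2) φ ^ 2 + sobolevNorm lam (d + 2) ρ ^ 2) := by
  have hsol := isInverseSolution_inverseSol hlam hq0 hq1 hα0 hα1 hm hT hφ hρ
  have hsource := (inverseSource_bound hlam hq0 hq1 hα0 hα1 hm hT hφ hρ).1
  exact ⟨hsol, hsource,
    fun hd => hsol.exists_hilbert_solution ψ hL hlam hψ hq0 hq1 hα0 hα1 hd hsource,
    fun _ _ hv => hv.unique hlam hq0 hq1 hα0 hα1 hm hT hsol,
    fun _ ht => sobolevHasSum_inverseSol_sub hlam hq0 hq1 hα0 hα1 hm hT hφ hρ ψ ht.1,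
    sobolevHasSum_sub_inverseSource hlam hq0 hq1 hα0 hα1 hm hT hφ hρ ψ,
    fun k => sub_pos.1 (one_sub_mlMode_pos hq0 hq1 hα0 hα1
      (add_pos_of_nonneg_of_pos (hlam k) hm) hT),
    fun _ ht =>
      sq_sobolevNorm_caputo_inverseSol_add_le hlam hq0 hq1 hα0 hα1 hm hT hφ hρ ht.1,
    sq_sobolevNorm_inverseSource_le hlam hq0 hq1 hα0 hα1 hm hT hφ hρ⟩

theorem theorem5p1 {𝕜 ι H : Type*} [RCLike 𝕜] [Countable ι] [NormedAddCommGroup H]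
    [InnerProductSpace 𝕜 H] [CompleteSpace H]
    (L : H →ₗ.[𝕜] H) (hL : IsSelfAdjoint L)
    (ψ : HilbertBasis ι 𝕜 H) (lam : ι → ℝ) (hlam : ∀ k, 0 ≤ lam k)
    (hψ : ∀ k, ∃ h : ψ k ∈ L.domain, L ⟨ψ k, h⟩ = (lam k : 𝕜) • ψ k)
    (q α m T : ℝ) (hq0 : 0 < q) (hq1 : q < 1) (hα0 : 0 < α) (hα1 : α < 1)
    (hm : 0 < m) (hT : 0 < T) :
    ∃ C : ℝ, 0 < C ∧ ∀ (d : ℝ) (φ ρ : ι → 𝕜),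
      MemSobolev lam (d + 2) φ → MemSobolev lam (d + 2) ρ →
      ∃ (u : ℝ → ι → 𝕜) (f : ι → 𝕜),
        -- existence, with `u` in both function spaces
        IsInverseSolution lam q α m T d φ ρ u f ∧
        MemSobolev lam d f ∧
        -- for `d ≥ 0` everything takes place in `H`, with the operator `L` itself
        (0 ≤ d → ∃ (U : ℝ → H) (F : H),
          (∀ t ∈ Icc 0 T, eigenSeries ψ (U t) = u t) ∧ eigenSeries ψ F = f ∧
          ∀ t ∈ Ioc 0 T, (Summable fun n : ℕ => ‖caputoTerm 𝕜 q α U t n‖) ∧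
            ∃ h : U t ∈ L.domain, caputo 𝕜 q α U t + L ⟨U t, h⟩ + (m : 𝕜) • U t = F) ∧
        -- uniqueness
        (∀ (v : ℝ → ι → 𝕜) (g : ι → 𝕜), IsInverseSolution lam q α m T d φ ρ v g →
          (∀ t ∈ Icc 0 T, v t = u t) ∧ g = f) ∧
        -- the eigenfunction series of `u` and `f`
        (∀ t ∈ Icc 0 T, SobolevHasSum lam (d + 2)
          (fun k => ((φ k - ρ k) * ((qMittagLeffler q α 1 (-(lam k + m) * t ^ α) - 1 : ℝ) : 𝕜) /
            ((1 - qMittagLeffler q α 1 (-(lam k + m) * T ^ α) : ℝ) : 𝕜)) • eigenSeries ψ (ψ k))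
          (u t - φ)) ∧
        SobolevHasSum lam d
          (fun k => (((lam k + m : ℝ) : 𝕜) * (φ k - ρ k) /
            ((1 - qMittagLeffler q α 1 (-(lam k + m) * T ^ α) : ℝ) : 𝕜)) • eigenSeries ψ (ψ k))
          (seriesOp lam φ + (m : 𝕜) • φ - f) ∧
        (∀ k, qMittagLeffler q α 1 (-(lam k + m) * T ^ α) < 1) ∧
        -- the estimates
        (∀ t ∈ Ioc 0 T,
          sobolevNorm lam d (caputo 𝕜 q α u t) ^ 2 + sobolevNorm lam (d + 2) (u t) ^ 2 ≤
            C * (sobolevNorm lam (d + 2) φ ^ 2 + sobolevNorm lam (d + 2) ρ ^ 2)) ∧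
        sobolevNorm lam d f ^ 2 ≤
          C * (sobolevNorm lam (d + 2) φ ^ 2 + sobolevNorm lam (d + 2) ρ ^ 2) := by
  exact ⟨inverseConst q α m T, inverseConst_pos hq1 hm hT, fun d φ ρ hφ hρ => ⟨_, _,
    theorem5p1_general L hL ψ lam hlam hψ q α m T hq0 hq1 hα0 hα1 hm hT d φ ρ hφ hρ⟩⟩
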